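/- Let $\theta$ be an irrational number, and let $A_\theta$ be the irrational rotation C*-algebra: the crossed product of $C(\mathbb T)$ by the action of $\mathbb Z$ by powers of the rotation by the angle $2\pi\theta$, that is, the C*-algebra generated by two unitaries $u,v$ with $uv=e^{2\pi i\theta}vu$, realised in its regular representation on $\ell^2(\mathbb Z^2)$. Let $\tau_\theta$ be its unique normalized trace, $\tau_\theta(a)=\langle\delta_0,a\delta_0\rangle$. An $A_\theta$-$A_\theta$-equivalence bimodule is a complex vector space with commuting left and right $A_\theta$-actions that is both a full left Hilbert $A_\theta$-module with inner product ${}_{A_\theta}\langle\cdot,\cdot\rangle$ and a full right Hilbert $A_\theta$-module with inner product $\langle\cdot,\cdot\rangle_{A_\theta}$, such that ${}_{A_\theta}\langle x,y\rangle z=x\langle y,z\rangle_{A_\theta}$, and such that each action is by adjointable operators for the other inner product. An isomorphism of such bimodules is a linear bijection preserving both actions and both inner products. The tensor product $\mathcal E\otimes\mathcal F$ is the interior one over $A_\theta$: the separation and completion of the algebraic tensor product for the inner products $\langle x\otimes y,x'\otimes y'\rangle_{A_\theta}=\langle y,\langle x,x'\rangle_{A_\theta}y'\rangle_{A_\theta}$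 and ${}_{A_\theta}\langle x\otimes y,x'\otimes y'\rangle={}_{A_\theta}\langle x\,{}_{A_\theta}\langle y,y'\rangle,x'\rangle$. For a projection $q\in A_\theta$ and a $*$-isomorphism $\phi:A_\theta\to qA_\theta q$, let $\mathcal E_{\theta,\phi,q}$ be the equivalence bimodule $qA_\theta$ with the obvious right action, $\langle x,y\rangle_{A_\theta}=x^*y$, left action $a\cdot x=\phi(a)x$ and ${}_{A_\theta}\langle x,y\rangle=\phi^{-1}(xy^*)$; let $\mathcal F_{\theta,\phi,q}$ be the equivalence bimodule $A_\theta q$ with the obvious left action, ${}_{A_\theta}\langle x,y\rangle=xy^*$, right action $x\cdot a=x\phi(a)$ and $\langle x,y\rangle_{A_\theta}=\phi^{-1}(x^*y)$. Let $q_1,q_2\in A_\theta$ be projections and let $\phi_1:A_\theta\to q_1A_\theta q_1$ and $\phi_2:A_\theta\to q_2A_\theta q_2$ be $*$-isomorphisms. Put $q=\phi_2(q_1)$; this is a projection in $A_\theta$, and $\phi_2\circ\phi_1$ is a $*$-isomorphism from $A_\theta$ onto $qA_\theta q$. Then: 1. $\tau_\theta(q)=\tau_\theta(q_1)\tau_\theta(q_2)$,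 and $\mathcal E_{\theta,\phi_1,q_1}\otimes\mathcal E_{\theta,\phi_2,q_2}\cong\mathcal E_{\theta,\phi_2\circ\phi_1,q}$ as equivalence bimodules. 2. $\mathcal E_{\theta,\phi_1,q_1}\otimes\mathcal F_{\theta,\phi_1,q_1}$ and $\mathcal F_{\theta,\phi_1,q_1}\otimes\mathcal E_{\theta,\phi_1,q_1}$ are both isomorphic, as equivalence bimodules, to the trivial bimodule $A_\theta$ with the obvious actions and the inner products $xy^*$ and $x^*y$. -/

import Mathlib

set_option linter.unusedSimpArgs false

open MulOpposite
open scoped TensorProduct RightActions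

universe u v w

/-- An `A`-`B`-equivalence bimodule of unital C⋆-algebras: a complex vector space with commuting
left `A`- and right `B`-actions (the right action is written `ξ <• b`) which is at the same time a
full left Hilbert `A`-module with inner product `linner` (linear in the first variable) and a full
right Hilbert `B`-module with inner product `rinner` (linear in the second variable), such that
`linner ξ η • ζ = ξ <• rinner η ζ`. -/
structure EquivBimodule (A : Type v) (B : Type w) [CStarAlgebra A] [CStarAlgebra B] where
  carrier : Type u
  [normedAddCommGroup : NormedAddCommGroup carrier]
  [normedSpace : NormedSpace ℂ carrier]
  [completeSpace : CompleteSpace carrier]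
  [leftModule : Module A carrier]
  [rightModule : Module Bᵐᵒᵖ carrier]
  [leftTower : IsScalarTower ℂ A carrier]
  [rightTower : IsScalarTower ℂ Bᵐᵒᵖ carrier]
  [actionsCommute : SMulCommClass A Bᵐᵒᵖ carrier]
  linner : carrier → carrier → A
  rinner : carrier → carrier → B
  linner_add_left (ξ η ζ : carrier) : linner (ξ + η) ζ = linner ξ ζ + linner η ζ
  linner_smul_left (a : A) (ξ η : carrier) : linner (a • ξ) η = a * linner ξ η
  star_linner (ξ η : carrier) : star (linner ξ η) = linner η ξ
  linner_self_nonneg (ξ : carrier) : ∃ a : A, linner ξ ξ = star a * a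
  norm_linner_self (ξ : carrier) : ‖linner ξ ξ‖ = ‖ξ‖ ^ 2
  linner_full : Dense (Submodule.span ℂ {a : A | ∃ ξ η, linner ξ η = a} : Set A)
  rinner_add_right (ξ η ζ : carrier) : rinner ξ (η + ζ) = rinner ξ η + rinner ξ ζ
  rinner_smul_right (b : B) (ξ η : carrier) : rinner ξ (η <• b) = rinner ξ η * b
  star_rinner (ξ η : carrier) : star (rinner ξ η) = rinner η ξ
  rinner_self_nonneg (ξ : carrier) : ∃ b : B, rinner ξ ξ = star b * b
  norm_rinner_self (ξ : carrier) : ‖rinner ξ ξ‖ = ‖ξ‖ ^ 2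
  rinner_full : Dense (Submodule.span ℂ {b : B | ∃ ξ η, rinner ξ η = b} : Set B)
  linner_smul_right (b : B) (ξ η : carrier) : linner (ξ <• b) η = linner ξ (η <• star b)
  rinner_smul_left (a : A) (ξ η : carrier) : rinner (a • ξ) η = rinner ξ (star a • η)
  imprimitivity (ξ η ζ : carrier) : linner ξ η • ζ = ξ <• rinner η ζ

namespace EquivBimodule

attribute [instance] normedAddCommGroup normedSpace completeSpace leftModule rightModule leftTower
  rightTower actionsCommute

variable {A : Type v} {B : Type w} [CStarAlgebra A] [CStarAlgebra B]

/-- An isomorphism of equivalence bimodules: a linear bijection which respects both actions and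
both inner products. -/
structure Iso (E : EquivBimodule.{u} A B) (F : EquivBimodule.{u} A B) extends
    E.carrier ≃ₗ[ℂ] F.carrier where
  map_left (a : A) (ξ : E.carrier) : toFun (a • ξ) = a • toFun ξ
  map_right (b : B) (ξ : E.carrier) : toFun (ξ <• b) = toFun ξ <• b
  map_linner (ξ η : E.carrier) : F.linner (toFun ξ) (toFun η) = E.linner ξ η
  map_rinner (ξ η : E.carrier) : F.rinner (toFun ξ) (toFun η) = E.rinner ξ η

/-- The existence of an isomorphism of equivalence bimodules. -/
def Isomorphic (E F : EquivBimodule.{u} A B) : Prop := Nonempty (Iso E F)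

end EquivBimodule

/-- The algebraic data of an equivalence bimodule before completion: the inner products are only
required to be positive semidefinite, and the compatibility of the inner products holds up to
vectors of length zero. -/
structure PreEquivBimodule (A : Type v) (B : Type w) [CStarAlgebra A] [CStarAlgebra B] where
  carrier : Type u
  [addCommGroup : AddCommGroup carrier]
  [module : Module ℂ carrier]
  [leftModule : Module A carrier]
  [rightModule : Module Bᵐᵒᵖ carrier]
  [leftTower : IsScalarTower ℂ A carrier]
  [rightTower : IsScalarTower ℂ Bᵐᵒᵖ carrier]
  [actionsCommute : SMulCommClass A Bᵐᵒᵖ carrier]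
  linner : carrier → carrier → A
  rinner : carrier → carrier → B
  linner_add_left (ξ η ζ : carrier) : linner (ξ + η) ζ = linner ξ ζ + linner η ζ
  linner_smul_left (a : A) (ξ η : carrier) : linner (a • ξ) η = a * linner ξ η
  star_linner (ξ η : carrier) : star (linner ξ η) = linner η ξ
  linner_self_nonneg (ξ : carrier) : ∃ a : A, linner ξ ξ = star a * a
  linner_full : Dense (Submodule.span ℂ {a : A | ∃ ξ η, linner ξ η = a} : Set A)
  rinner_add_right (ξ η ζ : carrier) : rinner ξ (η + ζ) = rinner ξ η + rinner ξ ζ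
  rinner_smul_right (b : B) (ξ η : carrier) : rinner ξ (η <• b) = rinner ξ η * b
  star_rinner (ξ η : carrier) : star (rinner ξ η) = rinner η ξ
  rinner_self_nonneg (ξ : carrier) : ∃ b : B, rinner ξ ξ = star b * b
  rinner_full : Dense (Submodule.span ℂ {b : B | ∃ ξ η, rinner ξ η = b} : Set B)
  linner_smul_right (b : B) (ξ η : carrier) : linner (ξ <• b) η = linner ξ (η <• star b)
  rinner_smul_left (a : A) (ξ η : carrier) : rinner (a • ξ) η = rinner ξ (star a • η)
  rinner_imprimitivity (ξ η ζ χ : carrier) :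
    rinner χ (linner ξ η • ζ) = rinner χ ξ * rinner η ζ
  linner_imprimitivity (ξ η ζ χ : carrier) :
    linner (ξ <• rinner η ζ) χ = linner ξ η * linner ζ χ

namespace PreEquivBimodule

attribute [instance] addCommGroup module leftModule rightModule leftTower rightTower
  actionsCommute

variable {A : Type v} {B : Type w} [CStarAlgebra A] [CStarAlgebra B] (P : PreEquivBimodule.{u} A B)

theorem rinner_add_left (ξ η ζ : P.carrier) :
    P.rinner (ξ + η) ζ = P.rinner ξ ζ + P.rinner η ζ := by
  rw [← P.star_rinner, P.rinner_add_right, star_add, P.star_rinner, P.star_rinner]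

theorem linner_add_right (ξ η ζ : P.carrier) :
    P.linner ξ (η + ζ) = P.linner ξ η + P.linner ξ ζ := by
  rw [← P.star_linner, P.linner_add_left, star_add, P.star_linner, P.star_linner]

theorem rinner_csmul_right (z : ℂ) (ξ η : P.carrier) :
    P.rinner ξ (z • η) = z • P.rinner ξ η := by
  have h : z • η = η <• (z • (1 : B)) := by
    rw [op_smul, op_one, smul_assoc, one_smul]
  rw [h, P.rinner_smul_right, mul_smul_comm, mul_one]

theorem linner_csmul_left (z : ℂ) (ξ η : P.carrier) :
    P.linner (z • ξ) η = z • P.linner ξ η := by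
  rw [← smul_one_smul A z ξ, P.linner_smul_left, smul_mul_assoc, one_mul]

theorem rinner_csmul_left (z : ℂ) (ξ η : P.carrier) :
    P.rinner (z • ξ) η = star z • P.rinner ξ η := by
  rw [← P.star_rinner, P.rinner_csmul_right, star_smul, P.star_rinner]

theorem linner_csmul_right (z : ℂ) (ξ η : P.carrier) :
    P.linner ξ (z • η) = star z • P.linner ξ η := by
  rw [← P.star_linner, P.linner_csmul_left, star_smul, P.star_linner]

/-- The inner product with values in `B` as a sesquilinear map. -/
noncomputable def rform : P.carrier →ₗ⋆[ℂ] P.carrier →ₗ[ℂ] B :=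
  LinearMap.mk₂'ₛₗ (starRingEnd ℂ) (RingHom.id ℂ) P.rinner P.rinner_add_left P.rinner_csmul_left
    P.rinner_add_right P.rinner_csmul_right

/-- The inner product with values in `A` as a sesquilinear map. -/
noncomputable def lform : P.carrier →ₗ[ℂ] P.carrier →ₗ⋆[ℂ] A :=
  LinearMap.mk₂'ₛₗ (RingHom.id ℂ) (starRingEnd ℂ) P.linner P.linner_add_left P.linner_csmul_left
    P.linner_add_right P.linner_csmul_right

theorem norm_rinner_smul_self_le (a : A) (ξ : P.carrier) :
    ‖P.rinner (a • ξ) (a • ξ)‖ ≤ ‖a‖ ^ 2 * ‖P.rinner ξ ξ‖ := by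
  let := CStarAlgebra.spectralOrder A
  let := CStarAlgebra.spectralOrderedRing A
  let := CStarAlgebra.spectralOrder B
  let := CStarAlgebra.spectralOrderedRing B
  have h := CStarAlgebra.star_mul_le_algebraMap_norm_sq (a := a)
  obtain ⟨c, hc⟩ := CStarAlgebra.nonneg_iff_eq_star_mul_self.1 (sub_nonneg.2 h)
  obtain ⟨d, hd⟩ := P.rinner_self_nonneg (c • ξ)
  obtain ⟨e, he⟩ := P.rinner_self_nonneg (a • ξ)
  have key : P.rinner (a • ξ) (a • ξ) + P.rinner (c • ξ) (c • ξ)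
      = ((‖a‖ ^ 2 : ℝ) : ℂ) • P.rinner ξ ξ := by
    rw [P.rinner_smul_left, P.rinner_smul_left, ← P.rinner_add_right, ← P.rinner_csmul_right,
      ← mul_smul, ← mul_smul, ← add_smul, ← hc, add_sub_cancel, Algebra.algebraMap_eq_smul_one,
      ← smul_one_smul A (((‖a‖ ^ 2 : ℝ) : ℂ)) ξ, Complex.coe_smul]
  calc ‖P.rinner (a • ξ) (a • ξ)‖
      ≤ ‖P.rinner (a • ξ) (a • ξ) + P.rinner (c • ξ) (c • ξ)‖ := by
        refine CStarAlgebra.norm_le_norm_of_nonneg_of_le ?_ ?_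
        · rw [he]; exact star_mul_self_nonneg e
        · rw [hd]; exact le_add_of_nonneg_right (star_mul_self_nonneg d)
    _ = ‖a‖ ^ 2 * ‖P.rinner ξ ξ‖ := by
        rw [key, norm_smul, Complex.norm_real, Real.norm_of_nonneg (sq_nonneg _)]

theorem norm_linner_smul_self_le (b : B) (ξ : P.carrier) :
    ‖P.linner (ξ <• b) (ξ <• b)‖ ≤ ‖b‖ ^ 2 * ‖P.linner ξ ξ‖ := by
  let := CStarAlgebra.spectralOrder A
  let := CStarAlgebra.spectralOrderedRing A
  let := CStarAlgebra.spectralOrder B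
  let := CStarAlgebra.spectralOrderedRing B
  have h := CStarAlgebra.star_mul_le_algebraMap_norm_sq (a := star b)
  rw [star_star, norm_star] at h
  obtain ⟨c, hc⟩ := CStarAlgebra.nonneg_iff_eq_mul_star_self.1 (sub_nonneg.2 h)
  obtain ⟨d, hd⟩ := P.linner_self_nonneg (ξ <• c)
  obtain ⟨e, he⟩ := P.linner_self_nonneg (ξ <• b)
  have key : P.linner (ξ <• b) (ξ <• b) + P.linner (ξ <• c) (ξ <• c)
      = ((‖b‖ ^ 2 : ℝ) : ℂ) • P.linner ξ ξ := by
    have h2 : ∀ b : B, P.linner (ξ <• b) (ξ <• b) = P.linner (ξ <• (b * star b)) ξ := by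
      intro b
      rw [op_mul, mul_smul, P.linner_smul_right (star b), star_star]
    rw [h2, h2, ← P.linner_add_left, ← P.linner_csmul_left, ← add_smul, ← op_add, ← hc,
      add_sub_cancel, Algebra.algebraMap_eq_smul_one, op_smul, op_one,
      ← smul_one_smul Bᵐᵒᵖ (((‖b‖ ^ 2 : ℝ) : ℂ)) ξ, Complex.coe_smul]
  calc ‖P.linner (ξ <• b) (ξ <• b)‖
      ≤ ‖P.linner (ξ <• b) (ξ <• b) + P.linner (ξ <• c) (ξ <• c)‖ := by
        refine CStarAlgebra.norm_le_norm_of_nonneg_of_le ?_ ?_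
        · rw [he]; exact star_mul_self_nonneg e
        · rw [hd]; exact le_add_of_nonneg_right (star_mul_self_nonneg d)
    _ = ‖b‖ ^ 2 * ‖P.linner ξ ξ‖ := by
        rw [key, norm_smul, Complex.norm_real, Real.norm_of_nonneg (sq_nonneg _)]

theorem norm_rinner_smul_le (a : A) (ξ : P.carrier) (h : ∃ c : A, a = star c * c) :
    ‖P.rinner ξ (a • ξ)‖ ≤ ‖a‖ * ‖P.rinner ξ ξ‖ := by
  obtain ⟨c, rfl⟩ := h
  have := P.norm_rinner_smul_self_le c ξ
  rw [P.rinner_smul_left, ← mul_smul] at this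
  rwa [CStarRing.norm_star_mul_self, ← sq]

theorem norm_linner_smul_le (b : B) (ξ : P.carrier) (h : ∃ c : B, b = star c * c) :
    ‖P.linner (ξ <• b) ξ‖ ≤ ‖b‖ * ‖P.linner ξ ξ‖ := by
  obtain ⟨c, rfl⟩ := h
  have := P.norm_linner_smul_self_le (star c) ξ
  rw [norm_star] at this
  rwa [CStarRing.norm_star_mul_self, ← sq, op_mul, mul_smul, P.linner_smul_right]

theorem norm_rinner_sq_le (ξ η : P.carrier) :
    ‖P.rinner ξ η‖ ^ 2 ≤ ‖P.linner ξ ξ‖ * ‖P.rinner η η‖ := by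
  have h : ‖P.rinner ξ η‖ ^ 2 = ‖P.rinner η (P.linner ξ ξ • η)‖ := by
    rw [P.rinner_imprimitivity, ← P.star_rinner ξ η, CStarRing.norm_star_mul_self, sq]
  rw [h]
  exact P.norm_rinner_smul_le _ _ (P.linner_self_nonneg ξ)

theorem norm_linner_sq_le (ξ η : P.carrier) :
    ‖P.linner ξ η‖ ^ 2 ≤ ‖P.rinner η η‖ * ‖P.linner ξ ξ‖ := by
  have h : ‖P.linner ξ η‖ ^ 2 = ‖P.linner (ξ <• P.rinner η η) ξ‖ := by
    rw [P.linner_imprimitivity, ← P.star_linner ξ η, CStarRing.norm_self_mul_star, sq]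
  rw [h]
  exact P.norm_linner_smul_le _ _ (P.rinner_self_nonneg η)

theorem norm_linner_self (ξ : P.carrier) : ‖P.linner ξ ξ‖ = ‖P.rinner ξ ξ‖ := by
  have h1 := P.norm_rinner_sq_le ξ ξ
  have h2 := P.norm_linner_sq_le ξ ξ
  have h3 := norm_nonneg (P.linner ξ ξ)
  have h4 := norm_nonneg (P.rinner ξ ξ)
  by_contra h
  rcases lt_or_gt_of_ne h with h | h <;> nlinarith

/-- The seminorm `‖ξ‖ = ‖⟨ξ, ξ⟩‖ ^ (1 / 2)`. -/
noncomputable instance norm : Norm P.carrier := ⟨fun ξ => √‖P.rinner ξ ξ‖⟩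

theorem norm_sq (ξ : P.carrier) : ‖ξ‖ ^ 2 = ‖P.rinner ξ ξ‖ := Real.sq_sqrt (norm_nonneg _)

theorem norm_nonneg' (ξ : P.carrier) : 0 ≤ ‖ξ‖ := Real.sqrt_nonneg _

theorem norm_rinner_le (ξ η : P.carrier) : ‖P.rinner ξ η‖ ≤ ‖ξ‖ * ‖η‖ := by
  refine le_of_sq_le_sq ?_ (mul_nonneg (P.norm_nonneg' ξ) (P.norm_nonneg' η))
  rw [mul_pow, P.norm_sq, P.norm_sq, ← P.norm_linner_self ξ]
  exact P.norm_rinner_sq_le ξ η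

theorem norm_linner_le (ξ η : P.carrier) : ‖P.linner ξ η‖ ≤ ‖ξ‖ * ‖η‖ := by
  refine le_of_sq_le_sq ?_ (mul_nonneg (P.norm_nonneg' ξ) (P.norm_nonneg' η))
  rw [mul_pow, P.norm_sq, P.norm_sq, ← P.norm_linner_self ξ, mul_comm]
  exact P.norm_linner_sq_le ξ η

theorem normCore : SeminormedSpace.Core ℂ P.carrier where
  norm_nonneg := P.norm_nonneg'
  norm_smul z ξ := by
    refine (sq_eq_sq₀ (P.norm_nonneg' _) (mul_nonneg (norm_nonneg z) (P.norm_nonneg' ξ))).1 ?_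
    rw [mul_pow, P.norm_sq, P.norm_sq, P.rinner_csmul_left, P.rinner_csmul_right, norm_smul,
      norm_smul, norm_star, sq, mul_assoc]
  norm_triangle ξ η := by
    refine le_of_sq_le_sq ?_ (add_nonneg (P.norm_nonneg' ξ) (P.norm_nonneg' η))
    rw [P.norm_sq, P.rinner_add_left, P.rinner_add_right, P.rinner_add_right]
    have h1 := P.norm_rinner_le ξ η
    have h2 := P.norm_rinner_le η ξ
    have h3 := P.norm_rinner_le ξ ξ
    have h4 := P.norm_rinner_le η η
    have h5 := norm_add_le (P.rinner ξ ξ + P.rinner ξ η) (P.rinner η ξ + P.rinner η η)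
    have h6 := norm_add_le (P.rinner ξ ξ) (P.rinner ξ η)
    have h7 := norm_add_le (P.rinner η ξ) (P.rinner η η)
    nlinarith

noncomputable instance seminormedAddCommGroup : SeminormedAddCommGroup P.carrier :=
  .ofCore P.normCore

noncomputable instance normedSpace : NormedSpace ℂ P.carrier where
  norm_smul_le z ξ := (P.normCore.norm_smul z ξ).le

theorem norm_smul_le (a : A) (ξ : P.carrier) : ‖a • ξ‖ ≤ ‖a‖ * ‖ξ‖ := by
  refine le_of_sq_le_sq ?_ (mul_nonneg (norm_nonneg a) (P.norm_nonneg' ξ))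
  rw [mul_pow, P.norm_sq, P.norm_sq]
  exact P.norm_rinner_smul_self_le a ξ

theorem norm_op_smul_le (b : B) (ξ : P.carrier) : ‖ξ <• b‖ ≤ ‖b‖ * ‖ξ‖ := by
  refine le_of_sq_le_sq ?_ (mul_nonneg (norm_nonneg b) (P.norm_nonneg' ξ))
  rw [mul_pow, P.norm_sq, P.norm_sq, ← P.norm_linner_self, ← P.norm_linner_self]
  exact P.norm_linner_smul_self_le b ξ

instance uniformContinuousConstSMul_left : UniformContinuousConstSMul A P.carrier where
  uniformContinuous_const_smul a :=
    (AddMonoidHomClass.lipschitz_of_bound (DistribSMul.toAddMonoidHom P.carrier a) ‖a‖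
      (P.norm_smul_le a)).uniformContinuous

instance uniformContinuousConstSMul_right : UniformContinuousConstSMul Bᵐᵒᵖ P.carrier where
  uniformContinuous_const_smul b :=
    (AddMonoidHomClass.lipschitz_of_bound (DistribSMul.toAddMonoidHom P.carrier b) ‖unop b‖
      (P.norm_op_smul_le (unop b))).uniformContinuous

end PreEquivBimodule

section Extension

variable {V W : Type*} [SeminormedAddCommGroup V] [NormedSpace ℂ V] [NormedAddCommGroup W]
  [NormedSpace ℂ W] [CompleteSpace W] {σ₁ σ₂ : ℂ →+* ℂ} [RingHomIsometric σ₁] [RingHomIsometric σ₂]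

/-- The continuous extension of a continuous sesquilinear map to the completion, in both
variables. -/
noncomputable def completionExtend₂ (f : V →SL[σ₁] V →SL[σ₂] W) :
    UniformSpace.Completion V →SL[σ₁] UniformSpace.Completion V →SL[σ₂] W :=
  ((f.extend UniformSpace.Completion.toComplL).flip.extend UniformSpace.Completion.toComplL).flip

theorem completionExtend₂_coe (f : V →SL[σ₁] V →SL[σ₂] W) (x y : V) :
    completionExtend₂ f (x : UniformSpace.Completion V) (y : UniformSpace.Completion V)
      = f x y := by
  have hd : DenseRange (UniformSpace.Completion.toComplL : V →L[ℂ] UniformSpace.Completion V) :=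
    UniformSpace.Completion.denseRange_coe
  have hu : IsUniformInducing
      (UniformSpace.Completion.toComplL : V →L[ℂ] UniformSpace.Completion V) :=
    UniformSpace.Completion.isUniformInducing_coe V
  have h1 := (f.extend UniformSpace.Completion.toComplL).flip.extend_eq hd hu y
  have h2 := f.extend_eq hd hu x
  rw [UniformSpace.Completion.coe_toComplL] at h1 h2
  rw [completionExtend₂, ContinuousLinearMap.flip_apply, h1, ContinuousLinearMap.flip_apply, h2]

theorem continuous_completionExtend₂ (f : V →SL[σ₁] V →SL[σ₂] W) {X : Type*} [TopologicalSpace X]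
    {g h : X → UniformSpace.Completion V} (hg : Continuous g) (hh : Continuous h) :
    Continuous fun x => completionExtend₂ f (g x) (h x) := by
  set F := completionExtend₂ f
  refine continuous_iff_continuousAt.2 fun x₀ => tendsto_iff_norm_sub_tendsto_zero.2 ?_
  have h1 : Filter.Tendsto (fun x => ‖F‖ * ‖g x - g x₀‖ * ‖h x‖ + ‖F (g x₀) (h x) - F (g x₀) (h x₀)‖)
      (nhds x₀) (nhds (‖F‖ * ‖g x₀ - g x₀‖ * ‖h x₀‖ + ‖F (g x₀) (h x₀) - F (g x₀) (h x₀)‖)) := by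
    have h2 : Continuous fun x => F (g x₀) (h x) := (F (g x₀)).continuous.comp hh
    exact Continuous.tendsto (by fun_prop) x₀
  rw [sub_self, norm_zero, mul_zero, zero_mul, sub_self, norm_zero, add_zero] at h1
  refine squeeze_zero (fun _ => norm_nonneg _) (fun x => ?_) h1
  have h3 : F (g x) (h x) - F (g x₀) (h x₀)
      = F (g x - g x₀) (h x) + (F (g x₀) (h x) - F (g x₀) (h x₀)) := by
    rw [map_sub, sub_apply, sub_add_sub_cancel]
  rw [h3]
  exact (norm_add_le _ _).trans (add_le_add_left (F.le_opNorm₂ _ _) _)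

end Extension

theorem isClosed_setOf_star_mul_self (A : Type*) [CStarAlgebra A] :
    IsClosed {a : A | ∃ c : A, a = star c * c} := by
  let := CStarAlgebra.spectralOrder A
  let := CStarAlgebra.spectralOrderedRing A
  simp_rw [← CStarAlgebra.nonneg_iff_eq_star_mul_self]
  exact CStarAlgebra.isClosed_nonneg

namespace PreEquivBimodule

variable {A : Type v} {B : Type w} [CStarAlgebra A] [CStarAlgebra B] (P : PreEquivBimodule.{u} A B)

/-- The inner product with values in `B` as a continuous sesquilinear map. -/
noncomputable def rcont : P.carrier →L⋆[ℂ] P.carrier →L[ℂ] B :=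
  P.rform.mkContinuous₂ 1 fun ξ η => by
    rw [one_mul]
    exact P.norm_rinner_le ξ η

/-- The inner product with values in `A` as a continuous sesquilinear map. -/
noncomputable def lcont : P.carrier →L[ℂ] P.carrier →L⋆[ℂ] A :=
  P.lform.mkContinuous₂ 1 fun ξ η => by
    rw [one_mul]
    exact P.norm_linner_le ξ η

theorem rext_coe (ξ η : P.carrier) : completionExtend₂ P.rcont ξ η = P.rinner ξ η :=
  completionExtend₂_coe _ _ _

theorem lext_coe (ξ η : P.carrier) : completionExtend₂ P.lcont ξ η = P.linner ξ η :=
  completionExtend₂_coe _ _ _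

theorem norm_imprimitivity (ξ η ζ : P.carrier) :
    ‖P.linner ξ η • ζ - ξ <• P.rinner η ζ‖ = 0 := by
  have h : ∀ χ : P.carrier, P.rinner χ (P.linner ξ η • ζ - ξ <• P.rinner η ζ) = 0 := by
    intro χ
    rw [sub_eq_add_neg, ← neg_one_smul ℂ (ξ <• P.rinner η ζ), P.rinner_add_right,
      P.rinner_csmul_right, P.rinner_imprimitivity, P.rinner_smul_right, neg_one_smul,
      add_neg_cancel]
  rw [← sq_eq_zero_iff, P.norm_sq, h, norm_zero]

instance isBoundedSMul_left : IsBoundedSMul A (UniformSpace.Completion P.carrier) :=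
  .of_norm_smul_le fun a ξ => by
    refine UniformSpace.Completion.induction_on ξ (isClosed_le
      (continuous_const_smul _).norm (continuous_const.mul continuous_norm))
      fun ξ => ?_
    rw [← UniformSpace.Completion.coe_smul, UniformSpace.Completion.norm_coe,
      UniformSpace.Completion.norm_coe]
    exact P.norm_smul_le a ξ

instance isBoundedSMul_right : IsBoundedSMul Bᵐᵒᵖ (UniformSpace.Completion P.carrier) :=
  .of_norm_smul_le fun b ξ => by
    refine UniformSpace.Completion.induction_on ξ (isClosed_le
      (continuous_const_smul _).norm (continuous_const.mul continuous_norm))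
      fun ξ => ?_
    rw [← UniformSpace.Completion.coe_smul, UniformSpace.Completion.norm_coe,
      UniformSpace.Completion.norm_coe]
    exact P.norm_op_smul_le (unop b) ξ

open UniformSpace.Completion in
/-- The equivalence bimodule obtained from `P` by dividing out the vectors of length zero and
completing; actions and inner products are extended by continuity. -/
noncomputable def completion : EquivBimodule.{u} A B where
  carrier := UniformSpace.Completion P.carrier
  linner ξ η := completionExtend₂ P.lcont ξ η
  rinner ξ η := completionExtend₂ P.rcont ξ η
  linner_add_left ξ η ζ := by rw [map_add]; rfl
  linner_smul_left a ξ η := by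
    refine induction_on₂ ξ η (isClosed_eq
      (continuous_completionExtend₂ _ (continuous_fst.const_smul a) continuous_snd)
      (continuous_const.mul (continuous_completionExtend₂ _ continuous_fst continuous_snd)))
      fun ξ η => ?_
    rw [← coe_smul, lext_coe, lext_coe, P.linner_smul_left]
  star_linner ξ η := by
    refine induction_on₂ ξ η (isClosed_eq
      (continuous_completionExtend₂ _ continuous_fst continuous_snd).star
      (continuous_completionExtend₂ _ continuous_snd continuous_fst)) fun ξ η => ?_
    rw [lext_coe, lext_coe, P.star_linner]
  linner_self_nonneg ξ := by
    refine induction_on ξ ((isClosed_setOf_star_mul_self A).preimage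
      (continuous_completionExtend₂ P.lcont continuous_id continuous_id)) fun ξ => ?_
    rw [lext_coe]
    exact P.linner_self_nonneg ξ
  norm_linner_self ξ := by
    refine induction_on ξ (isClosed_eq
      (continuous_completionExtend₂ P.lcont continuous_id continuous_id).norm
      (continuous_norm.pow 2)) fun ξ => ?_
    rw [lext_coe, norm_coe, P.norm_linner_self, P.norm_sq]
  linner_full := by
    refine P.linner_full.mono (Submodule.span_mono ?_)
    rintro _ ⟨ξ, η, rfl⟩
    exact ⟨ξ, η, P.lext_coe ξ η⟩
  rinner_add_right ξ η ζ := map_add _ _ _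
  rinner_smul_right b ξ η := by
    refine induction_on₂ ξ η (isClosed_eq
      (continuous_completionExtend₂ _ continuous_fst (continuous_snd.const_smul (op b)))
      ((continuous_completionExtend₂ _ continuous_fst continuous_snd).mul continuous_const))
      fun ξ η => ?_
    rw [← coe_smul, rext_coe, rext_coe, P.rinner_smul_right]
  star_rinner ξ η := by
    refine induction_on₂ ξ η (isClosed_eq
      (continuous_completionExtend₂ _ continuous_fst continuous_snd).star
      (continuous_completionExtend₂ _ continuous_snd continuous_fst)) fun ξ η => ?_
    rw [rext_coe, rext_coe, P.star_rinner]
  rinner_self_nonneg ξ := by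
    refine induction_on ξ ((isClosed_setOf_star_mul_self B).preimage
      (continuous_completionExtend₂ P.rcont continuous_id continuous_id)) fun ξ => ?_
    rw [rext_coe]
    exact P.rinner_self_nonneg ξ
  norm_rinner_self ξ := by
    refine induction_on ξ (isClosed_eq
      (continuous_completionExtend₂ P.rcont continuous_id continuous_id).norm
      (continuous_norm.pow 2)) fun ξ => ?_
    rw [rext_coe, norm_coe, P.norm_sq]
  rinner_full := by
    refine P.rinner_full.mono (Submodule.span_mono ?_)
    rintro _ ⟨ξ, η, rfl⟩
    exact ⟨ξ, η, P.rext_coe ξ η⟩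
  linner_smul_right b ξ η := by
    refine induction_on₂ ξ η (isClosed_eq
      (continuous_completionExtend₂ _ (continuous_fst.const_smul (op b)) continuous_snd)
      (continuous_completionExtend₂ _ continuous_fst (continuous_snd.const_smul (op (star b)))))
      fun ξ η => ?_
    rw [← coe_smul, ← coe_smul, lext_coe, lext_coe, P.linner_smul_right]
  rinner_smul_left a ξ η := by
    refine induction_on₂ ξ η (isClosed_eq
      (continuous_completionExtend₂ _ (continuous_fst.const_smul a) continuous_snd)
      (continuous_completionExtend₂ _ continuous_fst (continuous_snd.const_smul (star a))))
      fun ξ η => ?_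
    rw [← coe_smul, ← coe_smul, rext_coe, rext_coe, P.rinner_smul_left]
  imprimitivity ξ η ζ := by
    refine induction_on₃ ξ η ζ (isClosed_eq
      ((continuous_completionExtend₂ P.lcont continuous_fst
        (continuous_fst.comp continuous_snd)).smul (continuous_snd.comp continuous_snd))
      ((continuous_op.comp (continuous_completionExtend₂ P.rcont
        (continuous_fst.comp continuous_snd) (continuous_snd.comp continuous_snd))).smul
          continuous_fst)) fun ξ η ζ => ?_
    rw [lext_coe, rext_coe, ← coe_smul, ← coe_smul, ← sub_eq_zero, ← coe_sub, ← norm_eq_zero,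
      norm_coe]
    exact P.norm_imprimitivity ξ η ζ

end PreEquivBimodule

theorem exists_sum_star_mul_self {A : Type*} [CStarAlgebra A] {ι : Type*} (s : Finset ι)
    (f : ι → A) (hf : ∀ i ∈ s, ∃ a, f i = star a * a) : ∃ a, ∑ i ∈ s, f i = star a * a := by
  let := CStarAlgebra.spectralOrder A
  let := CStarAlgebra.spectralOrderedRing A
  simp_rw [← CStarAlgebra.nonneg_iff_eq_star_mul_self] at hf ⊢
  exact Finset.sum_nonneg hf

/-- If `s = d + 2` with `d` positive, then `r * s * r = 1` for some self-adjoint `r`. -/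
theorem exists_conj_eq_one {A : Type*} [CStarAlgebra A] (s : A)
    (hs : ∃ a, s - 2 = star a * a) : ∃ r : A, star r = r ∧ r * s * r = 1 := by
  let := CStarAlgebra.spectralOrder A
  let := CStarAlgebra.spectralOrderedRing A
  rw [← CStarAlgebra.nonneg_iff_eq_star_mul_self, sub_nonneg] at hs
  have h1 : (1 : A) ≤ s := by
    refine le_trans ?_ hs
    rw [← one_add_one_eq_two]
    exact le_add_of_nonneg_right zero_le_one
  have h2 : IsStrictlyPositive s := IsStrictlyPositive.of_le isStrictlyPositive_one h1
  exact ⟨s ^ (-(1 / 2) : ℝ), (IsSelfAdjoint.of_nonneg CFC.rpow_nonneg).star_eq,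
    CFC.conjugate_rpow_neg_one_half s h2⟩

theorem exists_isUnit_of_dense_span {A : Type*} [CStarAlgebra A] {S : Set A}
    (h : Dense (Submodule.span ℂ S : Set A)) :
    ∃ (n : ℕ) (z : Fin n → ℂ) (g : Fin n → S) (d : A), d * ∑ i, z i • (g i : A) = 1 ∧
      (∑ i, z i • (g i : A)) * d = 1 := by
  obtain ⟨c, hc, hlt⟩ := Metric.dense_iff.1 h 1 1 one_pos
  obtain ⟨n, z, g, rfl⟩ := Submodule.mem_span_set'.1 hlt
  rw [mem_ball_iff_norm'] at hc
  have hu := (Units.oneSub _ hc).isUnit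
  rw [Units.val_oneSub, sub_sub_cancel] at hu
  obtain ⟨u, hu⟩ := hu
  exact ⟨n, z, g, ↑u⁻¹, by rw [← hu, Units.inv_mul], by rw [← hu, Units.mul_inv]⟩

namespace PreEquivBimodule

variable {A : Type v} {B : Type w} [CStarAlgebra A] [CStarAlgebra B] (P : PreEquivBimodule.{u} A B)

theorem linner_smul_right' (a : A) (ξ η : P.carrier) :
    P.linner ξ (a • η) = P.linner ξ η * star a := by
  rw [← P.star_linner, P.linner_smul_left, star_mul, P.star_linner]

theorem rinner_smul_left' (b : B) (ξ η : P.carrier) :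
    P.rinner (ξ <• b) η = star b * P.rinner ξ η := by
  rw [← P.star_rinner, P.rinner_smul_right, star_mul, P.star_rinner]

theorem linner_sub_self (ξ η : P.carrier) : P.linner (ξ - η) (ξ - η)
    = P.linner ξ ξ + P.linner η η - (P.linner ξ η + P.linner η ξ) := by
  rw [sub_eq_add_neg ξ η, ← neg_one_smul ℂ η, P.linner_add_left, P.linner_add_right,
    P.linner_add_right, P.linner_csmul_left, P.linner_csmul_left, P.linner_csmul_right,
    P.linner_csmul_right, star_neg, star_one, neg_one_smul, neg_one_smul, neg_one_smul, neg_one_smul, neg_neg]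
  abel

theorem rinner_sub_self (ξ η : P.carrier) : P.rinner (ξ - η) (ξ - η)
    = P.rinner ξ ξ + P.rinner η η - (P.rinner ξ η + P.rinner η ξ) := by
  rw [sub_eq_add_neg ξ η, ← neg_one_smul ℂ η, P.rinner_add_left, P.rinner_add_right,
    P.rinner_add_right, P.rinner_csmul_left, P.rinner_csmul_left, P.rinner_csmul_right,
    P.rinner_csmul_right, star_neg, star_one, neg_one_smul, neg_one_smul, neg_one_smul, neg_one_smul, neg_neg]
  abel

theorem exists_lframe : ∃ (ι : Type) (_ : Fintype ι) (w : ι → P.carrier),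
    ∑ i, P.linner (w i) (w i) = 1 := by
  obtain ⟨n, z, g, d, h1, -⟩ := exists_isUnit_of_dense_span P.linner_full
  choose ξ η h using fun i => (g i).2
  set α : Fin n → P.carrier := fun i => d • z i • ξ i
  have h2 : ∑ i, P.linner (α i) (η i) = 1 := by
    rw [← h1, Finset.mul_sum]
    refine Finset.sum_congr rfl fun i _ => ?_
    rw [P.linner_smul_left, P.linner_csmul_left, h]
  have h3 : ∑ i, P.linner (η i) (α i) = 1 := by
    rw [← star_one, ← h2, star_sum]
    exact Finset.sum_congr rfl fun i _ => (P.star_linner _ _).symm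
  obtain ⟨r, hr, hs⟩ := exists_conj_eq_one
    (∑ i, P.linner (α i) (α i) + ∑ i, P.linner (η i) (η i)) (by
      obtain ⟨a, ha⟩ := exists_sum_star_mul_self Finset.univ
        (fun i => P.linner (α i - η i) (α i - η i)) fun i _ => P.linner_self_nonneg _
      refine ⟨a, ?_⟩
      rw [← ha]
      simp_rw [P.linner_sub_self]
      rw [Finset.sum_sub_distrib, Finset.sum_add_distrib, Finset.sum_add_distrib, h2, h3,
        one_add_one_eq_two])
  refine ⟨Fin n ⊕ Fin n, inferInstance, Sum.elim (fun i => r • α i) (fun i => r • η i), ?_⟩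
  rw [Fintype.sum_sum_type, ← hs, mul_add, add_mul]
  simp_rw [Sum.elim_inl, Sum.elim_inr, P.linner_smul_left, P.linner_smul_right', hr,
    Finset.mul_sum, Finset.sum_mul, mul_assoc]

theorem exists_rframe : ∃ (ι : Type) (_ : Fintype ι) (w : ι → P.carrier),
    ∑ i, P.rinner (w i) (w i) = 1 := by
  obtain ⟨n, z, g, d, -, h1⟩ := exists_isUnit_of_dense_span P.rinner_full
  choose ξ η h using fun i => (g i).2
  set α : Fin n → P.carrier := fun i => (z i • η i) <• d
  have h2 : ∑ i, P.rinner (ξ i) (α i) = 1 := by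
    rw [← h1, Finset.sum_mul]
    refine Finset.sum_congr rfl fun i _ => ?_
    rw [P.rinner_smul_right, P.rinner_csmul_right, h]
  have h3 : ∑ i, P.rinner (α i) (ξ i) = 1 := by
    rw [← star_one, ← h2, star_sum]
    exact Finset.sum_congr rfl fun i _ => (P.star_rinner _ _).symm
  obtain ⟨r, hr, hs⟩ := exists_conj_eq_one
    (∑ i, P.rinner (ξ i) (ξ i) + ∑ i, P.rinner (α i) (α i)) (by
      obtain ⟨a, ha⟩ := exists_sum_star_mul_self Finset.univ
        (fun i => P.rinner (ξ i - α i) (ξ i - α i)) fun i _ => P.rinner_self_nonneg _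
      refine ⟨a, ?_⟩
      rw [← ha]
      simp_rw [P.rinner_sub_self]
      rw [Finset.sum_sub_distrib, Finset.sum_add_distrib, Finset.sum_add_distrib, h2, h3,
        one_add_one_eq_two])
  refine ⟨Fin n ⊕ Fin n, inferInstance, Sum.elim (fun i => ξ i <• r) (fun i => α i <• r), ?_⟩
  rw [Fintype.sum_sum_type, ← hs, mul_add, add_mul]
  simp_rw [Sum.elim_inl, Sum.elim_inr, P.rinner_smul_right, P.rinner_smul_left', hr,
    Finset.mul_sum, Finset.sum_mul]

end PreEquivBimodule

namespace EquivBimodule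

universe u₁ u₂ w'

variable {A : Type v} {B : Type w} {C : Type w'} [CStarAlgebra A] [CStarAlgebra B] [CStarAlgebra C]

/-- An equivalence bimodule, with the norm forgotten. -/
@[reducible]
def toPre (E : EquivBimodule.{u} A B) : PreEquivBimodule.{u} A B where
  carrier := E.carrier
  linner := E.linner
  rinner := E.rinner
  linner_add_left := E.linner_add_left
  linner_smul_left := E.linner_smul_left
  star_linner := E.star_linner
  linner_self_nonneg := E.linner_self_nonneg
  linner_full := E.linner_full
  rinner_add_right := E.rinner_add_right
  rinner_smul_right := E.rinner_smul_right
  star_rinner := E.star_rinner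
  rinner_self_nonneg := E.rinner_self_nonneg
  rinner_full := E.rinner_full
  linner_smul_right := E.linner_smul_right
  rinner_smul_left := E.rinner_smul_left
  rinner_imprimitivity ξ η ζ χ := by rw [E.imprimitivity, E.rinner_smul_right]
  linner_imprimitivity ξ η ζ χ := by rw [← E.imprimitivity, E.linner_smul_left]

section

variable (E : EquivBimodule.{u} A B)

theorem rinner_add_left (ξ η ζ : E.carrier) :
    E.rinner (ξ + η) ζ = E.rinner ξ ζ + E.rinner η ζ :=
  E.toPre.rinner_add_left ξ η ζ

theorem linner_add_right (ξ η ζ : E.carrier) :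
    E.linner ξ (η + ζ) = E.linner ξ η + E.linner ξ ζ :=
  E.toPre.linner_add_right ξ η ζ

theorem rinner_csmul_right (z : ℂ) (ξ η : E.carrier) :
    E.rinner ξ (z • η) = z • E.rinner ξ η :=
  E.toPre.rinner_csmul_right z ξ η

theorem linner_csmul_left (z : ℂ) (ξ η : E.carrier) :
    E.linner (z • ξ) η = z • E.linner ξ η :=
  E.toPre.linner_csmul_left z ξ η

theorem rinner_csmul_left (z : ℂ) (ξ η : E.carrier) :
    E.rinner (z • ξ) η = star z • E.rinner ξ η :=
  E.toPre.rinner_csmul_left z ξ η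

theorem linner_csmul_right (z : ℂ) (ξ η : E.carrier) :
    E.linner ξ (z • η) = star z • E.linner ξ η :=
  E.toPre.linner_csmul_right z ξ η

theorem exists_lframe : ∃ (ι : Type) (_ : Fintype ι) (w : ι → E.carrier),
    ∑ i, E.linner (w i) (w i) = 1 :=
  E.toPre.exists_lframe

theorem exists_rframe : ∃ (ι : Type) (_ : Fintype ι) (w : ι → E.carrier),
    ∑ i, E.rinner (w i) (w i) = 1 :=
  E.toPre.exists_rframe

end

variable (E : EquivBimodule.{u₁} A B) (F : EquivBimodule.{u₂} B C)

/-- The algebraic tensor product. -/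
def PreTensor : Type (max u₁ u₂) := E.carrier ⊗[ℂ] F.carrier

namespace PreTensor

noncomputable instance : AddCommGroup (PreTensor E F) :=
  inferInstanceAs (AddCommGroup (E.carrier ⊗[ℂ] F.carrier))

noncomputable instance : Module ℂ (PreTensor E F) :=
  inferInstanceAs (Module ℂ (E.carrier ⊗[ℂ] F.carrier))

variable {E F}

/-- The elementary tensor `x ⊗ y`. -/
def tmul (x : E.carrier) (y : F.carrier) : PreTensor E F := x ⊗ₜ[ℂ] y

theorem induction {p : PreTensor E F → Prop} (t : PreTensor E F)
    (h : ∀ x y, p (tmul x y)) (hadd : ∀ s t, p s → p t → p (s + t)) : p t := by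
  refine TensorProduct.induction_on t ?_ h hadd
  have := h 0 0
  rwa [tmul, TensorProduct.zero_tmul] at this

variable (E F)

/-- `A` acts on the left factor. -/
noncomputable instance : Module A (PreTensor E F) :=
  Module.compHom (E.carrier ⊗[ℂ] F.carrier)
    ((Module.End.rTensorAlgHom ℂ E.carrier F.carrier).comp
      (Algebra.lsmul ℂ ℂ E.carrier : A →ₐ[ℂ] Module.End ℂ E.carrier)).toRingHom

/-- `C` acts on the right factor. -/
noncomputable instance : Module Cᵐᵒᵖ (PreTensor E F) :=
  Module.compHom (E.carrier ⊗[ℂ] F.carrier)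
    ((Module.End.lTensorAlgHom ℂ F.carrier E.carrier).comp
      (Algebra.lsmul ℂ ℂ F.carrier : Cᵐᵒᵖ →ₐ[ℂ] Module.End ℂ F.carrier)).toRingHom

variable {E F}

theorem smul_tmul (a : A) (x : E.carrier) (y : F.carrier) : a • tmul x y = tmul (a • x) y := rfl

theorem tmul_op_smul (c : C) (x : E.carrier) (y : F.carrier) :
    (tmul x y) <• c = tmul x (y <• c) := rfl

theorem csmul_tmul (z : ℂ) (x : E.carrier) (y : F.carrier) :
    z • tmul x y = tmul (z • x) y := rfl

theorem csmul_tmul' (z : ℂ) (x : E.carrier) (y : F.carrier) :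
    z • tmul x y = tmul x (z • y) := TensorProduct.smul_tmul _ _ _

instance : IsScalarTower ℂ A (PreTensor E F) :=
  ⟨fun z a t => by
    induction t using induction with
    | h x y => rw [smul_tmul, smul_tmul, csmul_tmul, smul_assoc]
    | hadd s t hs ht => rw [smul_add, hs, ht, smul_add, smul_add]⟩

instance : IsScalarTower ℂ Cᵐᵒᵖ (PreTensor E F) :=
  ⟨fun z c t => by
    induction t using induction with
    | h x y =>
      rw [← op_unop c, ← op_smul, tmul_op_smul, tmul_op_smul, csmul_tmul', op_smul, smul_assoc]
    | hadd s t hs ht => rw [smul_add, hs, ht, smul_add, smul_add]⟩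

instance : SMulCommClass A Cᵐᵒᵖ (PreTensor E F) :=
  ⟨fun a c t => by
    induction t using induction with
    | h x y => rw [← op_unop c, tmul_op_smul, smul_tmul, smul_tmul, tmul_op_smul]
    | hadd s t hs ht => rw [smul_add, smul_add, hs, ht, smul_add, smul_add]⟩

/-- The universal property of the algebraic tensor product, for (semi)linear maps. -/
noncomputable def lift {D : Type*} [AddCommGroup D] [Module ℂ D] {σ : ℂ →+* ℂ}
    (f : E.carrier →ₛₗ[σ] F.carrier →ₛₗ[σ] D) : PreTensor E F →ₛₗ[σ] D :=
  TensorProduct.lift f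

theorem lift_tmul {D : Type*} [AddCommGroup D] [Module ℂ D] {σ : ℂ →+* ℂ}
    (f : E.carrier →ₛₗ[σ] F.carrier →ₛₗ[σ] D) (x : E.carrier) (y : F.carrier) :
    lift f (tmul x y) = f x y := rfl

theorem ext {D : Type*} [AddCommGroup D] [Module ℂ D] {σ : ℂ →+* ℂ}
    {f g : PreTensor E F →ₛₗ[σ] D} (h : ∀ x y, f (tmul x y) = g (tmul x y)) : f = g :=
  TensorProduct.ext' h

variable (E F)

/-- The semi-inner product `⟨x ⊗ y, x' ⊗ y'⟩ = ⟨y, ⟨x, x'⟩ • y'⟩` with values in `C`. -/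
noncomputable def rform : PreTensor E F →ₗ⋆[ℂ] PreTensor E F →ₗ[ℂ] C :=
  lift (LinearMap.mk₂'ₛₗ (starRingEnd ℂ) (starRingEnd ℂ)
    (fun x y => lift (LinearMap.mk₂ ℂ
      (fun x' y' => F.rinner y (E.rinner x x' • y'))
      (fun x₁ x₂ y' => by rw [E.rinner_add_right, add_smul, F.rinner_add_right])
      (fun z x' y' => by
        rw [E.rinner_csmul_right, smul_assoc, F.rinner_csmul_right])
      (fun x' y₁ y₂ => by rw [smul_add, F.rinner_add_right])
      (fun z x' y' => by rw [smul_comm, F.rinner_csmul_right])))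
    (fun x₁ x₂ y => ext fun x' y' => by
      rw [LinearMap.add_apply, lift_tmul, lift_tmul,
        lift_tmul, LinearMap.mk₂_apply, LinearMap.mk₂_apply, LinearMap.mk₂_apply,
        E.rinner_add_left, add_smul, F.rinner_add_right])
    (fun z x y => ext fun x' y' => by
      rw [LinearMap.smul_apply, lift_tmul, lift_tmul,
        LinearMap.mk₂_apply, LinearMap.mk₂_apply,
        E.rinner_csmul_left, smul_assoc, F.rinner_csmul_right]; rfl)
    (fun x y₁ y₂ => ext fun x' y' => by
      rw [LinearMap.add_apply, lift_tmul, lift_tmul,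
        lift_tmul, LinearMap.mk₂_apply, LinearMap.mk₂_apply, LinearMap.mk₂_apply,
        F.rinner_add_left])
    (fun z x y => ext fun x' y' => by
      rw [LinearMap.smul_apply, lift_tmul, lift_tmul,
        LinearMap.mk₂_apply, LinearMap.mk₂_apply, F.rinner_csmul_left]; rfl))

/-- The semi-inner product `⟨x ⊗ y, x' ⊗ y'⟩ = ⟨x <• ⟨y, y'⟩, x'⟩` with values in `A`. -/
noncomputable def lform : PreTensor E F →ₗ[ℂ] PreTensor E F →ₗ⋆[ℂ] A :=
  lift (LinearMap.mk₂'ₛₗ (RingHom.id ℂ) (RingHom.id ℂ)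
    (fun x y => lift (LinearMap.mk₂'ₛₗ (starRingEnd ℂ) (starRingEnd ℂ)
      (fun x' y' => E.linner (x <• F.linner y y') x')
      (fun x₁ x₂ y' => by rw [E.linner_add_right])
      (fun z x' y' => by rw [E.linner_csmul_right]; rfl)
      (fun x' y₁ y₂ => by rw [F.linner_add_right, op_add, add_smul, E.linner_add_left])
      (fun z x' y' => by
        rw [F.linner_csmul_right, op_smul, smul_assoc, E.linner_csmul_left]; rfl)))
    (fun x₁ x₂ y => ext fun x' y' => by
      rw [LinearMap.add_apply, lift_tmul, lift_tmul,
        lift_tmul, LinearMap.mk₂'ₛₗ_apply, LinearMap.mk₂'ₛₗ_apply,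
        LinearMap.mk₂'ₛₗ_apply, smul_add, E.linner_add_left])
    (fun z x y => ext fun x' y' => by
      rw [LinearMap.smul_apply, lift_tmul, lift_tmul,
        LinearMap.mk₂'ₛₗ_apply, LinearMap.mk₂'ₛₗ_apply, smul_comm, E.linner_csmul_left]; rfl)
    (fun x y₁ y₂ => ext fun x' y' => by
      rw [LinearMap.add_apply, lift_tmul, lift_tmul,
        lift_tmul, LinearMap.mk₂'ₛₗ_apply, LinearMap.mk₂'ₛₗ_apply,
        LinearMap.mk₂'ₛₗ_apply, F.linner_add_left, op_add, add_smul, E.linner_add_left])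
    (fun z x y => ext fun x' y' => by
      rw [LinearMap.smul_apply, lift_tmul, lift_tmul,
        LinearMap.mk₂'ₛₗ_apply, LinearMap.mk₂'ₛₗ_apply, F.linner_csmul_left, op_smul,
        smul_assoc, E.linner_csmul_left]; rfl))

variable {E F}

theorem rform_tmul (x x' : E.carrier) (y y' : F.carrier) :
    rform E F (tmul x y) (tmul x' y') = F.rinner y (E.rinner x x' • y') := rfl

theorem lform_tmul (x x' : E.carrier) (y y' : F.carrier) :
    lform E F (tmul x y) (tmul x' y') = E.linner (x <• F.linner y y') x' := rfl

theorem rform_add_left (s t u : PreTensor E F) :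
    rform E F (s + t) u = rform E F s u + rform E F t u := by rw [map_add]; rfl

theorem rform_add_right (s t u : PreTensor E F) :
    rform E F s (t + u) = rform E F s t + rform E F s u := map_add _ _ _

theorem lform_add_left (s t u : PreTensor E F) :
    lform E F (s + t) u = lform E F s u + lform E F t u := by rw [map_add]; rfl

theorem lform_add_right (s t u : PreTensor E F) :
    lform E F s (t + u) = lform E F s t + lform E F s u := map_add _ _ _

theorem rform_smul_right (c : C) (s t : PreTensor E F) :
    rform E F s (t <• c) = rform E F s t * c := by
  induction s using induction with
  | h x y =>
    induction t using induction with
    | h x' y' => rw [tmul_op_smul, rform_tmul, rform_tmul, smul_comm, F.rinner_smul_right]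
    | hadd t₁ t₂ h₁ h₂ =>
      simp only [rform_add_left, rform_add_right, lform_add_left, lform_add_right, smul_add,
        add_smul, op_add, star_add, add_mul, mul_add, h₁, h₂]
  | hadd s₁ s₂ h₁ h₂ =>
    simp only [rform_add_left, rform_add_right, lform_add_left, lform_add_right, smul_add,
      add_smul, op_add, star_add, add_mul, mul_add, h₁, h₂]

theorem lform_smul_left (a : A) (s t : PreTensor E F) :
    lform E F (a • s) t = a * lform E F s t := by
  induction s using induction with
  | h x y =>
    induction t using induction with
    | h x' y' => rw [smul_tmul, lform_tmul, lform_tmul, ← smul_comm, E.linner_smul_left]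
    | hadd t₁ t₂ h₁ h₂ =>
      simp only [rform_add_left, rform_add_right, lform_add_left, lform_add_right, smul_add,
        add_smul, op_add, star_add, add_mul, mul_add, h₁, h₂]
  | hadd s₁ s₂ h₁ h₂ =>
    simp only [rform_add_left, rform_add_right, lform_add_left, lform_add_right, smul_add,
      add_smul, op_add, star_add, add_mul, mul_add, h₁, h₂]

theorem star_rform (s t : PreTensor E F) : star (rform E F s t) = rform E F t s := by
  induction s using induction with
  | h x y =>
    induction t using induction with
    | h x' y' => rw [rform_tmul, rform_tmul, F.star_rinner, F.rinner_smul_left, E.star_rinner]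
    | hadd t₁ t₂ h₁ h₂ =>
      simp only [rform_add_left, rform_add_right, lform_add_left, lform_add_right, smul_add,
        add_smul, op_add, star_add, add_mul, mul_add, h₁, h₂]
  | hadd s₁ s₂ h₁ h₂ =>
    simp only [rform_add_left, rform_add_right, lform_add_left, lform_add_right, smul_add,
      add_smul, op_add, star_add, add_mul, mul_add, h₁, h₂]

theorem star_lform (s t : PreTensor E F) : star (lform E F s t) = lform E F t s := by
  induction s using induction with
  | h x y =>
    induction t using induction with
    | h x' y' => rw [lform_tmul, lform_tmul, E.star_linner, E.linner_smul_right, F.star_linner]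
    | hadd t₁ t₂ h₁ h₂ =>
      simp only [rform_add_left, rform_add_right, lform_add_left, lform_add_right, smul_add,
        add_smul, op_add, star_add, add_mul, mul_add, h₁, h₂]
  | hadd s₁ s₂ h₁ h₂ =>
    simp only [rform_add_left, rform_add_right, lform_add_left, lform_add_right, smul_add,
      add_smul, op_add, star_add, add_mul, mul_add, h₁, h₂]

theorem rform_smul_left (a : A) (s t : PreTensor E F) :
    rform E F (a • s) t = rform E F s (star a • t) := by
  induction s using induction with
  | h x y =>
    induction t using induction with
    | h x' y' => rw [smul_tmul, smul_tmul, rform_tmul, rform_tmul, E.rinner_smul_left]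
    | hadd t₁ t₂ h₁ h₂ =>
      simp only [rform_add_left, rform_add_right, lform_add_left, lform_add_right, smul_add,
        add_smul, op_add, star_add, add_mul, mul_add, h₁, h₂]
  | hadd s₁ s₂ h₁ h₂ =>
    simp only [rform_add_left, rform_add_right, lform_add_left, lform_add_right, smul_add,
      add_smul, op_add, star_add, add_mul, mul_add, h₁, h₂]

theorem lform_smul_right (c : C) (s t : PreTensor E F) :
    lform E F (s <• c) t = lform E F s (t <• star c) := by
  induction s using induction with
  | h x y =>
    induction t using induction with
    | h x' y' => rw [tmul_op_smul, tmul_op_smul, lform_tmul, lform_tmul, F.linner_smul_right]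
    | hadd t₁ t₂ h₁ h₂ =>
      simp only [rform_add_left, rform_add_right, lform_add_left, lform_add_right, smul_add,
        add_smul, op_add, star_add, add_mul, mul_add, h₁, h₂]
  | hadd s₁ s₂ h₁ h₂ =>
    simp only [rform_add_left, rform_add_right, lform_add_left, lform_add_right, smul_add,
      add_smul, op_add, star_add, add_mul, mul_add, h₁, h₂]

theorem rform_imprimitivity (s t u r : PreTensor E F) :
    rform E F r (lform E F s t • u) = rform E F r s * rform E F t u := by
  induction r using induction with
  | hadd r₁ r₂ h₁ h₂ =>
    simp only [rform_add_left, rform_add_right, lform_add_left, lform_add_right, smul_add,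
      add_smul, op_add, star_add, add_mul, mul_add, h₁, h₂]
  | h x₀ y₀ =>
  induction s using induction with
  | hadd s₁ s₂ h₁ h₂ =>
    simp only [rform_add_left, rform_add_right, lform_add_left, lform_add_right, smul_add,
      add_smul, op_add, star_add, add_mul, mul_add, h₁, h₂]
  | h x₁ y₁ =>
  induction t using induction with
  | hadd t₁ t₂ h₁ h₂ =>
    simp only [rform_add_left, rform_add_right, lform_add_left, lform_add_right, smul_add,
      add_smul, op_add, star_add, add_mul, mul_add, h₁, h₂]
  | h x₂ y₂ =>
  induction u using induction with
  | hadd u₁ u₂ h₁ h₂ =>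
    simp only [rform_add_left, rform_add_right, lform_add_left, lform_add_right, smul_add,
      add_smul, op_add, star_add, add_mul, mul_add, h₁, h₂]
  | h x₃ y₃ =>
  rw [smul_tmul, rform_tmul, rform_tmul, rform_tmul, lform_tmul, E.imprimitivity,
    E.rinner_smul_right, E.rinner_smul_right, mul_assoc, mul_smul, mul_smul, F.imprimitivity,
    smul_comm (E.rinner x₀ x₁), F.rinner_smul_right]

theorem lform_imprimitivity (s t u r : PreTensor E F) :
    lform E F (s <• rform E F t u) r = lform E F s t * lform E F u r := by
  induction r using induction with
  | hadd r₁ r₂ h₁ h₂ =>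
    simp only [rform_add_left, rform_add_right, lform_add_left, lform_add_right, smul_add,
      add_smul, op_add, star_add, add_mul, mul_add, h₁, h₂]
  | h x₀ y₀ =>
  induction s using induction with
  | hadd s₁ s₂ h₁ h₂ =>
    simp only [rform_add_left, rform_add_right, lform_add_left, lform_add_right, smul_add,
      add_smul, op_add, star_add, add_mul, mul_add, h₁, h₂]
  | h x₁ y₁ =>
  induction t using induction with
  | hadd t₁ t₂ h₁ h₂ =>
    simp only [rform_add_left, rform_add_right, lform_add_left, lform_add_right, smul_add,
      add_smul, op_add, star_add, add_mul, mul_add, h₁, h₂]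
  | h x₂ y₂ =>
  induction u using induction with
  | hadd u₁ u₂ h₁ h₂ =>
    simp only [rform_add_left, rform_add_right, lform_add_left, lform_add_right, smul_add,
      add_smul, op_add, star_add, add_mul, mul_add, h₁, h₂]
  | h x₃ y₃ =>
  rw [tmul_op_smul, rform_tmul, lform_tmul, lform_tmul, lform_tmul, ← F.imprimitivity,
    F.linner_smul_left, F.linner_smul_left, op_mul, op_mul, mul_smul, mul_smul, ← E.imprimitivity,
    ← smul_comm, E.linner_smul_left]

theorem rform_self_nonneg (t : PreTensor E F) : ∃ c : C, rform E F t t = star c * c := by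
  obtain ⟨ι, _, w, hw⟩ := E.exists_lframe
  let z (i : ι) : PreTensor E F →ₗ[ℂ] F.carrier := lift (LinearMap.mk₂ ℂ
    (fun x y => E.rinner (w i) x • y)
    (fun x₁ x₂ y => by rw [E.rinner_add_right, add_smul])
    (fun z x y => by rw [E.rinner_csmul_right, smul_assoc])
    (fun x y₁ y₂ => smul_add _ _ _)
    (fun z x y => smul_comm _ _ _))
  have hz : ∀ i x y, z i (tmul x y) = E.rinner (w i) x • y := fun i x y => rfl
  have key : ∀ s t : PreTensor E F, rform E F s t = ∑ i, F.rinner (z i s) (z i t) := by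
    intro s t
    induction s using induction with
    | hadd s₁ s₂ h₁ h₂ =>
      simp_rw [map_add (z _), F.rinner_add_left]
      rw [rform_add_left, h₁, h₂, Finset.sum_add_distrib]
    | h x y =>
    induction t using induction with
    | hadd t₁ t₂ h₁ h₂ =>
      simp_rw [map_add (z _), F.rinner_add_right]
      rw [rform_add_right, h₁, h₂, Finset.sum_add_distrib]
    | h x' y' =>
    simp_rw [hz, F.rinner_smul_left, E.star_rinner, ← mul_smul, ← E.rinner_smul_right,
      ← E.imprimitivity]
    have h1 : x' = ∑ i, E.linner (w i) (w i) • x' := by rw [← Finset.sum_smul, hw, one_smul]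
    have h2 : F.rinner y (E.rinner x (∑ i, E.linner (w i) (w i) • x') • y')
        = ∑ i, F.rinner y (E.rinner x (E.linner (w i) (w i) • x') • y') := by
      have h3 := map_sum (rform E F (tmul x y)) (fun i => tmul (E.linner (w i) (w i) • x') y')
        Finset.univ
      simp_rw [rform_tmul] at h3
      rw [← h3, ← rform_tmul]
      congr 1
      exact TensorProduct.sum_tmul _ _ _
    rw [rform_tmul, ← h2, ← h1]
  rw [key]
  exact exists_sum_star_mul_self _ _ fun i _ => F.rinner_self_nonneg _

theorem lform_self_nonneg (t : PreTensor E F) : ∃ a : A, lform E F t t = star a * a := by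
  obtain ⟨ι, _, w, hw⟩ := F.exists_rframe
  let z (i : ι) : PreTensor E F →ₗ[ℂ] E.carrier := lift (LinearMap.mk₂ ℂ
    (fun x y => x <• F.linner y (w i))
    (fun x₁ x₂ y => smul_add _ _ _)
    (fun z x y => smul_comm _ _ _)
    (fun x y₁ y₂ => by rw [F.linner_add_left, op_add, add_smul])
    (fun z x y => by rw [F.linner_csmul_left, op_smul, smul_assoc]))
  have hz : ∀ i x y, z i (tmul x y) = x <• F.linner y (w i) := fun i x y => rfl
  have key : ∀ s t : PreTensor E F, lform E F s t = ∑ i, E.linner (z i s) (z i t) := by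
    intro s t
    induction t using induction with
    | hadd t₁ t₂ h₁ h₂ =>
      simp_rw [map_add (z _), E.linner_add_right]
      rw [lform_add_right, h₁, h₂, Finset.sum_add_distrib]
    | h x' y' =>
    induction s using induction with
    | hadd s₁ s₂ h₁ h₂ =>
      simp_rw [map_add (z _), E.linner_add_left]
      rw [lform_add_left, h₁, h₂, Finset.sum_add_distrib]
    | h x y =>
    have h0 : ∀ i, E.linner (x <• F.linner y (w i)) (x' <• F.linner y' (w i))
        = E.linner (x <• F.linner (y <• F.rinner (w i) (w i)) y') x' := by
      intro i
      rw [← F.imprimitivity, F.linner_smul_left, op_mul, mul_smul, E.linner_smul_right _ (_ <• _),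
        F.star_linner]
    simp_rw [hz, h0]
    have h1 : y = ∑ i, y <• F.rinner (w i) (w i) := by
      rw [← Finset.sum_smul, ← Finset.op_sum, hw, op_one, one_smul]
    have h2 : lform E F (tmul x (∑ i, y <• F.rinner (w i) (w i))) (tmul x' y')
        = ∑ i, lform E F (tmul x (y <• F.rinner (w i) (w i))) (tmul x' y') := by
      have h3 : tmul x (∑ i, y <• F.rinner (w i) (w i))
          = ∑ i, tmul x (y <• F.rinner (w i) (w i)) := TensorProduct.tmul_sum _ _ _
      rw [h3, map_sum, LinearMap.sum_apply]
    simp_rw [← lform_tmul]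
    rw [← h2, ← h1]
  rw [key]
  exact exists_sum_star_mul_self _ _ fun i _ => E.linner_self_nonneg _

theorem rform_full :
    Dense (Submodule.span ℂ {c : C | ∃ s t, rform E F s t = c} : Set C) := by
  obtain ⟨ι, _, w, hw⟩ := E.exists_rframe
  refine F.rinner_full.mono (Submodule.span_le.2 ?_)
  rintro _ ⟨y, y', rfl⟩
  have h : F.rinner y y' = ∑ i, rform E F (tmul (w i) y) (tmul (w i) y') := by
    simp_rw [rform_tmul]
    have h1 := map_sum (F.toPre.rform y) (fun i => E.rinner (w i) (w i) • y') Finset.univ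
    rw [← Finset.sum_smul, hw, one_smul] at h1
    exact h1
  rw [h]
  exact Submodule.sum_mem _ fun i _ => Submodule.subset_span ⟨_, _, rfl⟩

theorem lform_full :
    Dense (Submodule.span ℂ {a : A | ∃ s t, lform E F s t = a} : Set A) := by
  obtain ⟨ι, _, w, hw⟩ := F.exists_lframe
  refine E.linner_full.mono (Submodule.span_le.2 ?_)
  rintro _ ⟨x, x', rfl⟩
  have h : E.linner x x' = ∑ i, lform E F (tmul x (w i)) (tmul x' (w i)) := by
    simp_rw [lform_tmul]
    have h1 := map_sum (E.toPre.lform.flip x') (fun i => x <• F.linner (w i) (w i)) Finset.univ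
    rw [← Finset.sum_smul, ← Finset.op_sum, hw, op_one, one_smul] at h1
    exact h1
  rw [h]
  exact Submodule.sum_mem _ fun i _ => Submodule.subset_span ⟨_, _, rfl⟩

end PreTensor

/-- The algebraic tensor product with its two semi-inner products. -/
noncomputable def preTensor : PreEquivBimodule.{max u₁ u₂} A C where
  carrier := PreTensor E F
  linner s t := PreTensor.lform E F s t
  rinner s t := PreTensor.rform E F s t
  linner_add_left := PreTensor.lform_add_left
  linner_smul_left := PreTensor.lform_smul_left
  star_linner := PreTensor.star_lform
  linner_self_nonneg := PreTensor.lform_self_nonneg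
  linner_full := PreTensor.lform_full
  rinner_add_right := PreTensor.rform_add_right
  rinner_smul_right := PreTensor.rform_smul_right
  star_rinner := PreTensor.star_rform
  rinner_self_nonneg := PreTensor.rform_self_nonneg
  rinner_full := PreTensor.rform_full
  linner_smul_right := PreTensor.lform_smul_right
  rinner_smul_left := PreTensor.rform_smul_left
  rinner_imprimitivity := PreTensor.rform_imprimitivity
  linner_imprimitivity := PreTensor.lform_imprimitivity

/-- The (interior) tensor product over `B` of an `A`-`B`-equivalence bimodule and a
`B`-`C`-equivalence bimodule: the separated completion of the algebraic tensor product with respect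
to the inner products `⟨x ⊗ y, x' ⊗ y'⟩ = ⟨y, ⟨x, x'⟩ • y'⟩` with values in `C` and
`⟨x ⊗ y, x' ⊗ y'⟩ = ⟨x <• ⟨y, y'⟩, x'⟩` with values in `A`. The vectors
`x <• b ⊗ y - x ⊗ b • y` have length zero, so that they vanish in the completion. -/
noncomputable def tensor : EquivBimodule.{max u₁ u₂} A C := (preTensor E F).completion

end EquivBimodule

section Corner

variable {A : Type u} [CStarAlgebra A] {q : A}

/-- The corner `qAq = {x | q * x = x ∧ x * q = x}` of a projection `q`. -/
def corner (hq : IsStarProjection q) : NonUnitalStarSubalgebra ℂ A where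
  carrier := {x | q * x = x ∧ x * q = x}
  add_mem' := fun {x y} hx hy =>
    ⟨by rw [mul_add, hx.1, hy.1], by rw [add_mul, hx.2, hy.2]⟩
  zero_mem' := ⟨mul_zero q, zero_mul q⟩
  mul_mem' := fun {x y} hx hy =>
    ⟨by rw [← mul_assoc, hx.1], by rw [mul_assoc, hy.2]⟩
  smul_mem' := fun z x hx =>
    ⟨by rw [mul_smul_comm, hx.1], by rw [smul_mul_assoc, hx.2]⟩
  star_mem' := fun {x} hx =>
    ⟨by rw [← hq.isSelfAdjoint.star_eq, ← star_mul, hx.2],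
      by rw [← hq.isSelfAdjoint.star_eq, ← star_mul, hx.1]⟩

noncomputable instance corner_nonUnitalRing (hq : IsStarProjection q) : NonUnitalRing (corner hq) :=
  inferInstance

noncomputable instance corner_add (hq : IsStarProjection q) : Add (corner hq) := inferInstance

noncomputable instance corner_mul (hq : IsStarProjection q) : Mul (corner hq) := inferInstance

noncomputable instance corner_star (hq : IsStarProjection q) : Star (corner hq) := inferInstance

noncomputable instance corner_smul (hq : IsStarProjection q) : SMul ℂ (corner hq) := inferInstance

/-- The right ideal `qA = {x | q * x = x}` of an idempotent `q`. -/
def rightIdeal (q : A) : Submodule ℂ A where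
  carrier := {x | q * x = x}
  add_mem' := fun {x y} (hx : q * x = x) (hy : q * y = y) =>
    show q * (x + y) = x + y by rw [mul_add, hx, hy]
  zero_mem' := mul_zero q
  smul_mem' := fun z x (hx : q * x = x) =>
    show q * (z • x) = z • x by rw [mul_smul_comm, hx]

/-- The left ideal `Aq = {x | x * q = x}` of an idempotent `q`. -/
def leftIdeal (q : A) : Submodule ℂ A where
  carrier := {x | x * q = x}
  add_mem' := fun {x y} (hx : x * q = x) (hy : y * q = y) =>
    show (x + y) * q = x + y by rw [add_mul, hx, hy]
  zero_mem' := zero_mul q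
  smul_mem' := fun z x (hx : x * q = x) =>
    show (z • x) * q = z • x by rw [smul_mul_assoc, hx]

theorem rightIdeal_eq (x : rightIdeal q) : q * (x : A) = x := x.2

theorem leftIdeal_eq (x : leftIdeal q) : (x : A) * q = x := x.2

theorem isClosed_rightIdeal (q : A) : IsClosed (rightIdeal q : Set A) :=
  isClosed_eq (continuous_const_mul q) continuous_id

theorem isClosed_leftIdeal (q : A) : IsClosed (leftIdeal q : Set A) :=
  isClosed_eq (continuous_mul_const q) continuous_id

theorem mul_star_mem_corner (hq : IsStarProjection q) (x y : rightIdeal q) :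
    (x : A) * star (y : A) ∈ corner hq :=
  ⟨by rw [← mul_assoc, rightIdeal_eq], by
    have h := congrArg star (rightIdeal_eq y)
    rw [star_mul, hq.isSelfAdjoint.star_eq] at h
    rw [mul_assoc, h]⟩

theorem star_mul_mem_corner (hq : IsStarProjection q) (x y : leftIdeal q) :
    star (x : A) * (y : A) ∈ corner hq :=
  ⟨by
    have h := congrArg star (leftIdeal_eq x)
    rw [star_mul, hq.isSelfAdjoint.star_eq] at h
    rw [← mul_assoc, h], by rw [mul_assoc, leftIdeal_eq]⟩

/-- A projection is full if the two-sided ideal which it generates is dense. -/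
def IsFullProjection (q : A) : Prop :=
  Dense (Submodule.span ℂ {x : A | ∃ a b, a * q * b = x} : Set A)

variable {hq : IsStarProjection q}

theorem cornerEquiv_norm (φ : A ≃⋆ₐ[ℂ] corner hq) (a : A) : ‖(φ a : A)‖ = ‖a‖ := by
  let ψ : A →⋆ₙₐ[ℂ] A := (NonUnitalStarSubalgebraClass.subtype (corner hq)).comp
    (φ : A →⋆ₙₐ[ℂ] corner hq)
  exact NonUnitalStarAlgHom.norm_map ψ (Subtype.val_injective.comp φ.injective) a

theorem cornerEquiv_symm_norm (φ : A ≃⋆ₐ[ℂ] corner hq) (x : corner hq) :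
    ‖φ.symm x‖ = ‖(x : A)‖ := by
  rw [← cornerEquiv_norm φ, φ.apply_symm_apply]

theorem cornerEquiv_symm_eq (φ : A ≃⋆ₐ[ℂ] corner hq) (x : corner hq) (a : A)
    (h : (x : A) = φ a) : φ.symm x = a := by
  rw [show x = φ a from Subtype.ext h, φ.symm_apply_apply]

theorem cornerEquiv_one (φ : A ≃⋆ₐ[ℂ] corner hq) : (φ 1 : A) = q := by
  have hmem : q ∈ corner hq := ⟨hq.isIdempotentElem.eq, hq.isIdempotentElem.eq⟩
  have h : φ 1 * (⟨q, hmem⟩ : corner hq) = ⟨q, hmem⟩ := by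
    rw [← φ.apply_symm_apply ⟨q, hmem⟩, ← map_mul, one_mul]
  have h2 := congrArg (Subtype.val) h
  exact ((φ 1).2.2).symm.trans h2

theorem cornerEquiv_symm_nonneg (φ : A ≃⋆ₐ[ℂ] corner hq) (x : corner hq)
    (h : ∃ a : A, (x : A) = star a * a) : ∃ b : A, φ.symm x = star b * b := by
  let := CStarAlgebra.spectralOrder A
  let := CStarAlgebra.spectralOrderedRing A
  obtain ⟨a, ha⟩ := h
  have h0 : 0 ≤ (x : A) := by rw [ha]; exact star_mul_self_nonneg a
  set c := CFC.sqrt (x : A)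
  have hc : star c = c := (IsSelfAdjoint.of_nonneg (CFC.sqrt_nonneg (x : A))).star_eq
  have hcc : c * c = x := CFC.sqrt_mul_sqrt_self (x : A) h0
  have h1 : c * (1 - q) = 0 := by
    rw [← CStarRing.star_mul_self_eq_zero_iff, star_mul, hc, mul_assoc, ← mul_assoc c, hcc,
      mul_sub, mul_one, x.2.2, sub_self, mul_zero]
  rw [mul_sub, mul_one, sub_eq_zero] at h1
  have h2 : q * c = c := by
    have h3 := congrArg star h1
    rw [star_mul, hc, hq.isSelfAdjoint.star_eq] at h3
    exact h3.symm
  refine ⟨φ.symm ⟨c, h2, h1.symm⟩, ?_⟩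
  rw [← map_star, ← map_mul]
  exact congrArg φ.symm (Subtype.ext <| show (x : A) = star c * c by rw [hc, hcc])

/-- The left action on `qA`. -/
@[reducible]
noncomputable def rightIdealLeftModule (φ : A ≃⋆ₐ[ℂ] corner hq) : Module A (rightIdeal q) :=
  { smul := fun a x => ⟨(φ a : A) * x, show q * _ = _ by rw [← mul_assoc, (φ a).2.1]⟩
    one_smul := fun x => Subtype.ext <| show (φ 1 : A) * x = x by
      rw [cornerEquiv_one, rightIdeal_eq]
    mul_smul := fun a b x => Subtype.ext <| show (φ (a * b) : A) * x = φ a * (φ b * x) by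
      rw [map_mul, ← mul_assoc]; rfl
    smul_zero := fun a => Subtype.ext <| mul_zero _
    smul_add := fun a x y => Subtype.ext <| mul_add _ _ _
    add_smul := fun a b x => Subtype.ext <| show (φ (a + b) : A) * x = φ a * x + φ b * x by
      rw [map_add, ← add_mul]; rfl
    zero_smul := fun x => Subtype.ext <| show (φ 0 : A) * x = 0 by
      rw [map_zero]; exact zero_mul _ }

/-- The right action on `qA`. -/
@[reducible]
noncomputable def rightIdealRightModule (q : A) : Module Aᵐᵒᵖ (rightIdeal q) :=
  { smul := fun b x => ⟨(x : A) * unop b, show q * _ = _ by rw [← mul_assoc, rightIdeal_eq]⟩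
    one_smul := fun x => Subtype.ext <| mul_one _
    mul_smul := fun a b x => Subtype.ext <| (mul_assoc _ _ _).symm
    smul_zero := fun a => Subtype.ext <| zero_mul _
    smul_add := fun a x y => Subtype.ext <| add_mul _ _ _
    add_smul := fun a b x => Subtype.ext <| mul_add _ _ _
    zero_smul := fun x => Subtype.ext <| mul_zero _ }

/-- The equivalence bimodule `qA` given by an isomorphism `φ` from `A` onto the corner of a full
projection `q`: the right `A`-action and the right inner product `⟨x, y⟩ = x⋆ y` are the obvious
ones, the left action is `a • x = φ a * x`, and the left inner product is `φ⁻¹ (x y⋆)`. -/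
noncomputable def rightIdealBimodule (hfull : IsFullProjection q) (φ : A ≃⋆ₐ[ℂ] corner hq) :
    EquivBimodule.{u} A A where
  carrier := rightIdeal q
  completeSpace := (isClosed_rightIdeal q).completeSpace_coe
  leftModule := rightIdealLeftModule φ
  rightModule := rightIdealRightModule q
  leftTower := let _ := rightIdealLeftModule φ; ⟨fun z a x => Subtype.ext <| show (φ (z • a) : A) * x = z • ((φ a : A) * x) by
    rw [map_smul, ← smul_mul_assoc]; rfl⟩
  rightTower := let _ := rightIdealRightModule q; ⟨fun z a x => Subtype.ext <| mul_smul_comm _ _ _⟩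
  actionsCommute := let _ := rightIdealLeftModule φ; let _ := rightIdealRightModule q; ⟨fun a b x => Subtype.ext <| (mul_assoc _ _ _).symm⟩
  linner x y := φ.symm ⟨(x : A) * star (y : A), mul_star_mem_corner hq x y⟩
  rinner x y := star (x : A) * y
  linner_add_left x y z := by
    rw [← map_add]; exact congrArg φ.symm (Subtype.ext <| add_mul _ _ _)
  linner_smul_left a x y := cornerEquiv_symm_eq φ _ _ <| by
    rw [map_mul, φ.apply_symm_apply]
    exact mul_assoc _ _ _
  star_linner x y := by
    rw [← map_star]
    exact congrArg φ.symm (Subtype.ext <| show star ((x : A) * star (y : A)) = _ by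
      rw [star_mul, star_star])
  linner_self_nonneg x := cornerEquiv_symm_nonneg φ _ ⟨star (x : A), by rw [star_star]⟩
  norm_linner_self x := by
    rw [cornerEquiv_symm_norm, sq]; exact CStarRing.norm_self_mul_star
  linner_full := by
    have h : {a : A | ∃ x y : rightIdeal q,
        φ.symm ⟨(x : A) * star (y : A), mul_star_mem_corner hq x y⟩ = a} = Set.univ := by
      refine Set.eq_univ_of_forall fun a => ⟨⟨φ a, (φ a).2.1⟩, ⟨q, hq.isIdempotentElem.eq⟩, ?_⟩
      exact cornerEquiv_symm_eq φ _ _ <| show (φ a : A) * star q = φ a by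
        rw [hq.isSelfAdjoint.star_eq, (φ a).2.2]
    rw [h, Submodule.span_univ]
    exact dense_univ
  rinner_add_right x y z := mul_add _ _ _
  rinner_smul_right b x y := (mul_assoc _ _ _).symm
  star_rinner x y := by rw [star_mul, star_star]
  rinner_self_nonneg x := ⟨x, rfl⟩
  norm_rinner_self x := by rw [sq]; exact CStarRing.norm_star_mul_self
  rinner_full := by
    refine hfull.mono (Submodule.span_mono ?_)
    rintro _ ⟨a, b, rfl⟩
    have hi : q * q = q := hq.isIdempotentElem.eq
    refine ⟨⟨q * star a, show q * _ = _ by rw [← mul_assoc, hi]⟩,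
      ⟨q * b, show q * _ = _ by rw [← mul_assoc, hi]⟩, ?_⟩
    change star (q * star a) * (q * b) = a * q * b
    rw [star_mul, star_star, hq.isSelfAdjoint.star_eq, mul_assoc, ← mul_assoc q q, hi, mul_assoc]
  linner_smul_right b x y := congrArg φ.symm <| Subtype.ext <|
    show (x : A) * b * star (y : A) = x * star ((y : A) * star b) by
      rw [star_mul, star_star, mul_assoc]
  rinner_smul_left a x y := by
    change star ((φ a : A) * x) * (y : A) = star (x : A) * ((φ (star a) : A) * y)
    rw [map_star, star_mul, mul_assoc]; rfl
  imprimitivity x y z := Subtype.ext <| by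
    change (φ (φ.symm ⟨(x : A) * star (y : A), mul_star_mem_corner hq x y⟩) : A) * (z : A)
      = (x : A) * (star (y : A) * z)
    rw [φ.apply_symm_apply, mul_assoc]

/-- The left action on `Aq`. -/
@[reducible]
noncomputable def leftIdealLeftModule (q : A) : Module A (leftIdeal q) :=
  { smul := fun a x => ⟨a * (x : A), show _ * q = _ by rw [mul_assoc, leftIdeal_eq]⟩
    one_smul := fun x => Subtype.ext <| one_mul _
    mul_smul := fun a b x => Subtype.ext <| mul_assoc _ _ _
    smul_zero := fun a => Subtype.ext <| mul_zero _
    smul_add := fun a x y => Subtype.ext <| mul_add _ _ _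
    add_smul := fun a b x => Subtype.ext <| add_mul _ _ _
    zero_smul := fun x => Subtype.ext <| zero_mul _ }

/-- The right action on `Aq`. -/
@[reducible]
noncomputable def leftIdealRightModule (φ : A ≃⋆ₐ[ℂ] corner hq) : Module Aᵐᵒᵖ (leftIdeal q) :=
  { smul := fun b x => ⟨(x : A) * φ (unop b), show _ * q = _ by
      rw [mul_assoc, (φ (unop b)).2.2]⟩
    one_smul := fun x => Subtype.ext <| show (x : A) * φ 1 = x by
      rw [cornerEquiv_one, leftIdeal_eq]
    mul_smul := fun a b x => Subtype.ext <|
      show (x : A) * φ (unop b * unop a) = x * φ (unop b) * φ (unop a) by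
        rw [map_mul, mul_assoc]; rfl
    smul_zero := fun a => Subtype.ext <| zero_mul _
    smul_add := fun a x y => Subtype.ext <| add_mul _ _ _
    add_smul := fun a b x => Subtype.ext <|
      show (x : A) * φ (unop a + unop b) = x * φ (unop a) + x * φ (unop b) by
        rw [map_add, ← mul_add]; rfl
    zero_smul := fun x => Subtype.ext <| show (x : A) * φ 0 = 0 by
      rw [map_zero]; exact mul_zero _ }

/-- The equivalence bimodule `Aq` given by an isomorphism `φ` from `A` onto the corner of a full
projection `q`: the left `A`-action and the left inner product `x y⋆` are the obvious ones, the
right action is `x <• a = x * φ a`, and the right inner product is `⟨x, y⟩ = φ⁻¹ (x⋆ y)`. -/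
noncomputable def leftIdealBimodule (hfull : IsFullProjection q) (φ : A ≃⋆ₐ[ℂ] corner hq) :
    EquivBimodule.{u} A A where
  carrier := leftIdeal q
  completeSpace := (isClosed_leftIdeal q).completeSpace_coe
  leftModule := leftIdealLeftModule q
  rightModule := leftIdealRightModule φ
  leftTower := let _ := leftIdealLeftModule q; ⟨fun z a x => Subtype.ext <| smul_mul_assoc _ _ _⟩
  rightTower := let _ := leftIdealRightModule φ; ⟨fun z a x => Subtype.ext <|
    show (x : A) * φ (z • unop a) = z • ((x : A) * φ (unop a)) by
      rw [map_smul, ← mul_smul_comm]; rfl⟩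
  actionsCommute := let _ := leftIdealLeftModule q; let _ := leftIdealRightModule φ; ⟨fun a b x => Subtype.ext <| (mul_assoc _ _ _).symm⟩
  linner x y := (x : A) * star (y : A)
  rinner x y := φ.symm ⟨star (x : A) * y, star_mul_mem_corner hq x y⟩
  linner_add_left x y z := add_mul _ _ _
  linner_smul_left a x y := mul_assoc _ _ _
  star_linner x y := by rw [star_mul, star_star]
  linner_self_nonneg x := ⟨star (x : A), by rw [star_star]⟩
  norm_linner_self x := by rw [sq]; exact CStarRing.norm_self_mul_star
  linner_full := by
    refine hfull.mono (Submodule.span_mono ?_)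
    rintro _ ⟨a, b, rfl⟩
    have hi : q * q = q := hq.isIdempotentElem.eq
    refine ⟨⟨a * q, show _ * q = _ by rw [mul_assoc, hi]⟩,
      ⟨star b * q, show _ * q = _ by rw [mul_assoc, hi]⟩, ?_⟩
    change a * q * star (star b * q) = a * q * b
    rw [star_mul, star_star, hq.isSelfAdjoint.star_eq, mul_assoc, ← mul_assoc q q, hi, mul_assoc]
  rinner_add_right x y z := by
    rw [← map_add]; exact congrArg φ.symm (Subtype.ext <| mul_add _ _ _)
  rinner_smul_right b x y := cornerEquiv_symm_eq φ _ _ <| by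
    rw [map_mul, φ.apply_symm_apply]
    exact (mul_assoc _ _ _).symm
  star_rinner x y := by
    rw [← map_star]
    exact congrArg φ.symm (Subtype.ext <| show star (star (x : A) * (y : A)) = _ by
      rw [star_mul, star_star])
  rinner_self_nonneg x := cornerEquiv_symm_nonneg φ _ ⟨x, rfl⟩
  norm_rinner_self x := by
    rw [cornerEquiv_symm_norm, sq]; exact CStarRing.norm_star_mul_self
  rinner_full := by
    have h : {a : A | ∃ x y : leftIdeal q,
        φ.symm ⟨star (x : A) * (y : A), star_mul_mem_corner hq x y⟩ = a} = Set.univ := by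
      refine Set.eq_univ_of_forall fun a => ⟨⟨q, hq.isIdempotentElem.eq⟩, ⟨φ a, (φ a).2.2⟩, ?_⟩
      exact cornerEquiv_symm_eq φ _ _ <| show star q * (φ a : A) = φ a by
        rw [hq.isSelfAdjoint.star_eq, (φ a).2.1]
    rw [h, Submodule.span_univ]
    exact dense_univ
  linner_smul_right b x y := by
    change (x : A) * φ b * star (y : A) = x * star ((y : A) * φ (star b))
    have h : (φ (star b) : A) = star (φ b : A) := by rw [map_star]; rfl
    rw [h, star_mul, star_star, mul_assoc]
  rinner_smul_left a x y := congrArg φ.symm <| Subtype.ext <|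
    show star (a * (x : A)) * (y : A) = star (x : A) * (star a * y) by
      rw [star_mul, mul_assoc]
  imprimitivity x y z := Subtype.ext <| by
    change (x : A) * star (y : A) * (z : A)
      = (x : A) * (φ (φ.symm ⟨star (y : A) * (z : A), star_mul_mem_corner hq y z⟩) : A)
    rw [φ.apply_symm_apply, mul_assoc]

variable (A) in
/-- The trivial equivalence bimodule `A`, with the obvious actions and inner products `x y⋆` and
`x⋆ y`. -/
noncomputable def trivialBimodule : EquivBimodule.{u} A A where
  carrier := A
  linner x y := x * star y
  rinner x y := star x * y
  linner_add_left x y z := add_mul _ _ _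
  linner_smul_left a x y := mul_assoc _ _ _
  star_linner x y := by rw [star_mul, star_star]
  linner_self_nonneg x := ⟨star x, by rw [star_star]⟩
  norm_linner_self x := by rw [sq]; exact CStarRing.norm_self_mul_star
  linner_full := by
    have h : {a : A | ∃ x y : A, x * star y = a} = Set.univ :=
      Set.eq_univ_of_forall fun a => ⟨a, 1, by rw [star_one, mul_one]⟩
    rw [h, Submodule.span_univ]
    exact dense_univ
  rinner_add_right x y z := mul_add _ _ _
  rinner_smul_right b x y := (mul_assoc _ _ _).symm
  star_rinner x y := by rw [star_mul, star_star]
  rinner_self_nonneg x := ⟨x, rfl⟩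
  norm_rinner_self x := by rw [sq]; exact CStarRing.norm_star_mul_self
  rinner_full := by
    have h : {a : A | ∃ x y : A, star x * y = a} = Set.univ :=
      Set.eq_univ_of_forall fun a => ⟨1, a, by rw [star_one, one_mul]⟩
    rw [h, Submodule.span_univ]
    exact dense_univ
  linner_smul_right b x y := by
    change x * b * star y = x * star (y * star b)
    rw [star_mul, star_star, mul_assoc]
  rinner_smul_left a x y := by
    change star (a * x) * y = star x * (star a * y)
    rw [star_mul, mul_assoc]
  imprimitivity x y z := mul_assoc _ _ _

end Corner

section RotationAlgebra

open scoped ENNReal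

/-- The Hilbert space `ℓ²(ℤ × ℤ)`. -/
abbrev SqSummable : Type := lp (fun _ : ℤ × ℤ => ℂ) 2

noncomputable instance sqSummable_cstarAlgebra : CStarAlgebra (SqSummable →L[ℂ] SqSummable) :=
  inferInstance

noncomputable instance sqSummable_ring : Ring (SqSummable →L[ℂ] SqSummable) := inferInstance

noncomputable instance sqSummable_mul : Mul (SqSummable →L[ℂ] SqSummable) := inferInstance

noncomputable instance sqSummable_add : Add (SqSummable →L[ℂ] SqSummable) := inferInstance

noncomputable instance sqSummable_addCommMonoid : AddCommMonoid (SqSummable →L[ℂ] SqSummable) :=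
  inferInstance

noncomputable instance sqSummable_star : Star (SqSummable →L[ℂ] SqSummable) := inferInstance

/-- The weighted shift `(T f) i = c i * f (i - g)` on `ℓ²(ℤ × ℤ)`, for a function `c` with values
in the unit circle. -/
noncomputable def weightedShift (c : ℤ × ℤ → Circle) (g : ℤ × ℤ) : SqSummable →L[ℂ] SqSummable :=
  LinearIsometry.toContinuousLinearMap
    { toFun := fun f => ⟨fun i => (c i : ℂ) * f (i - g), by
        have hf := (memℓp_gen_iff (p := 2) (by norm_num)).1 f.2
        refine memℓp_gen ?_
        simp_rw [norm_mul, Circle.norm_coe, one_mul]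
        exact hf.comp_injective (i := fun i => i - g) (Equiv.subRight g).injective⟩
      map_add' := fun f h => Subtype.ext <| funext fun i => mul_add (c i : ℂ) (f (i - g)) (h (i - g))
      map_smul' := fun z f => Subtype.ext <| funext fun i => mul_left_comm (c i : ℂ) z (f (i - g))
      norm_map' := fun f => by
        rw [lp.norm_eq_tsum_rpow (by norm_num), lp.norm_eq_tsum_rpow (by norm_num)]
        congr 1
        have h := (Equiv.subRight g).tsum_eq fun i => ‖f i‖ ^ (2 : ℝ≥0∞).toReal
        rw [← h]
        refine tsum_congr fun i => ?_
        change ‖(c i : ℂ) * f (i - g)‖ ^ _ = _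
        rw [norm_mul, Circle.norm_coe, one_mul]
        rfl }

theorem weightedShift_apply (c : ℤ × ℤ → Circle) (g : ℤ × ℤ) (f : SqSummable) (i : ℤ × ℤ) :
    weightedShift c g f i = c i * f (i - g) := rfl

/-- The C⋆-algebra `A_θ`: the crossed product of the continuous functions on the circle by the
powers of the rotation by the angle `2πθ`, in its regular representation. After a Fourier
transform in the circle variable, the regular representation is on `ℓ²(ℤ × ℤ)`; the coordinate
function of the circle acts as `(u f) (m, n) = exp (2πiθn) f (m - 1, n)` and the generator of `ℤ`
acts as `(v f) (m, n) = f (m, n - 1)`, so that `u v = exp (2πiθ) v u`, and `A_θ` is the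
C⋆-algebra generated by the unitaries `u` and `v`. -/
noncomputable def rotationSubalgebra (θ : ℝ) : StarSubalgebra ℂ (SqSummable →L[ℂ] SqSummable) :=
  (StarAlgebra.adjoin ℂ {weightedShift (fun i => Circle.exp (2 * Real.pi * θ * i.2)) (1, 0),
    weightedShift (fun _ => 1) (0, 1)}).topologicalClosure

instance isClosed_rotationSubalgebra (θ : ℝ) :
    IsClosed (rotationSubalgebra θ : Set (SqSummable →L[ℂ] SqSummable)) :=
  StarSubalgebra.isClosed_topologicalClosure _

/-- The rotation algebra `A_θ`, as a C⋆-algebra. -/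
abbrev RotationAlgebra (θ : ℝ) : Type := rotationSubalgebra θ

noncomputable instance rotationAlgebra_cstarAlgebra (θ : ℝ) : CStarAlgebra (RotationAlgebra θ) :=
  inferInstance

/-- The canonical (for irrational `θ`: the unique) normalized trace `a ↦ ⟨δ₀, a δ₀⟩` of `A_θ`. -/
noncomputable def rotationTrace (θ : ℝ) (a : RotationAlgebra θ) : ℂ :=
  inner ℂ (lp.single 2 (0 : ℤ × ℤ) (1 : ℂ)) ((a : SqSummable →L[ℂ] SqSummable) (lp.single 2 0 1))

variable {θ : ℝ}

/-- The operator `u ^ a * v ^ b`. -/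
noncomputable def rotM (θ : ℝ) (g : ℤ × ℤ) : SqSummable →L[ℂ] SqSummable :=
  weightedShift (fun i => Circle.exp (2 * Real.pi * θ * (g.1 * i.2))) g

/-- Weighted shifts in the commutant of `A_θ`. -/
noncomputable def rotR (θ : ℝ) (g : ℤ × ℤ) : SqSummable →L[ℂ] SqSummable :=
  weightedShift (fun i => Circle.exp (2 * Real.pi * θ * (g.2 * i.1))) g

/-- The scalar `exp (2πiθk)`. -/
noncomputable def rotScalar (θ : ℝ) (k : ℤ) : ℂ := Circle.exp (2 * Real.pi * θ * k)

theorem norm_rotScalar (k : ℤ) : ‖rotScalar θ k‖ = 1 := Circle.norm_coe _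

theorem rotScalar_add (k l : ℤ) : rotScalar θ (k + l) = rotScalar θ k * rotScalar θ l := by
  rw [rotScalar, rotScalar, rotScalar, ← Circle.coe_mul, ← Circle.exp_add]
  push_cast
  ring_nf

theorem rotScalar_zero : rotScalar θ 0 = 1 := by simp [rotScalar]

theorem rotScalar_ne_one (hθ : Irrational θ) {k : ℤ} (hk : k ≠ 0) : rotScalar θ k ≠ 1 := by
  intro h
  have h1 : Circle.exp (2 * Real.pi * θ * k) = 1 := Circle.coe_eq_one.1 h
  rw [Circle.exp_eq_one] at h1
  obtain ⟨m, hm⟩ := h1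
  have h2 : θ * k = m := by
    have := Real.pi_pos
    have h3 : (2 * Real.pi) * (θ * k) = (2 * Real.pi) * m := by linarith
    exact mul_left_cancel₀ (by positivity) h3
  exact (hθ.mul_intCast hk).ne_int m h2

theorem weightedShift_mul (c d : ℤ × ℤ → Circle) (g h : ℤ × ℤ) :
    weightedShift c g * weightedShift d h = weightedShift (fun i => c i * d (i - g)) (g + h) := by
  ext f i
  have h1 : (weightedShift c g * weightedShift d h) f i = (c i : ℂ) * (d (i - g) * f (i - g - h)) :=
    rfl
  rw [h1, weightedShift_apply, Circle.coe_mul, mul_assoc, sub_sub]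

theorem smul_weightedShift (z : Circle) (c : ℤ × ℤ → Circle) (g : ℤ × ℤ) :
    (z : ℂ) • weightedShift c g = weightedShift (fun i => z * c i) g := by
  ext f i
  have h1 : ((z : ℂ) • weightedShift c g) f i = (z : ℂ) * weightedShift c g f i := rfl
  rw [h1, weightedShift_apply, weightedShift_apply, Circle.coe_mul, mul_assoc]

theorem rotM_mul (g h : ℤ × ℤ) :
    rotM θ g * rotM θ h = rotScalar θ (-(h.1 * g.2)) • rotM θ (g + h) := by
  rw [rotM, rotM, rotM, rotScalar, weightedShift_mul, smul_weightedShift]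
  congr 1
  funext i
  rw [← Circle.exp_add, ← Circle.exp_add]
  congr 1
  simp only [Prod.fst_add, Prod.snd_sub]
  push_cast
  ring

theorem rotM_zero : rotM θ 0 = 1 := by
  ext f i
  change (Circle.exp _ : ℂ) * f (i - 0) = f i
  simp

theorem rotM_comm (g h : ℤ × ℤ) :
    rotM θ g * rotM θ h = rotScalar θ (g.1 * h.2 - h.1 * g.2) • (rotM θ h * rotM θ g) := by
  rw [rotM_mul, rotM_mul, smul_smul, ← rotScalar_add, add_comm h g]
  congr 2
  ring

theorem star_mul_weightedShift (c : ℤ × ℤ → Circle) (g : ℤ × ℤ) :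
    star (weightedShift c g) * weightedShift c g = 1 :=
  LinearIsometry.adjoint_comp_self _

theorem star_rotM (g : ℤ × ℤ) : star (rotM θ g) = rotScalar θ (-(g.1 * g.2)) • rotM θ (-g) := by
  have h1 : rotM θ g * (rotScalar θ (-(g.1 * g.2)) • rotM θ (-g)) = 1 := by
    rw [mul_smul_comm, rotM_mul, smul_smul, ← rotScalar_add, add_neg_cancel, rotM_zero]
    simp [rotScalar_zero]
  exact left_inv_eq_right_inv (star_mul_weightedShift _ _) h1

theorem rotM_mul_star (g : ℤ × ℤ) : rotM θ g * star (rotM θ g) = 1 := by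
  rw [star_rotM, mul_smul_comm, rotM_mul, smul_smul, ← rotScalar_add, add_neg_cancel, rotM_zero]
  simp [rotScalar_zero]

theorem rotR_comm_rotM (g h : ℤ × ℤ) : rotR θ g * rotM θ h = rotM θ h * rotR θ g := by
  rw [rotM, rotR, weightedShift_mul, weightedShift_mul, add_comm h g]
  congr 1
  funext i
  rw [← Circle.exp_add, ← Circle.exp_add]
  congr 1
  simp only [Prod.fst_sub, Prod.snd_sub]
  push_cast
  ring

theorem rotM_one_zero : rotM θ (1, 0)
    = weightedShift (fun i => Circle.exp (2 * Real.pi * θ * i.2)) (1, 0) := by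
  simp [rotM]

theorem rotM_zero_one : rotM θ (0, 1) = weightedShift (fun _ => 1) (0, 1) := by
  simp [rotM]

theorem rotM_mem (g : ℤ × ℤ) : rotM θ g ∈ rotationSubalgebra θ := by
  have hu : rotM θ (1, 0) ∈ rotationSubalgebra θ := by
    refine StarSubalgebra.le_topologicalClosure _ (StarAlgebra.subset_adjoin ℂ _ ?_)
    rw [rotM_one_zero]
    exact Set.mem_insert _ _
  have hv : rotM θ (0, 1) ∈ rotationSubalgebra θ := by
    refine StarSubalgebra.le_topologicalClosure _ (StarAlgebra.subset_adjoin ℂ _ ?_)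
    rw [rotM_zero_one]
    exact Set.mem_insert_of_mem _ rfl
  have hu' : rotM θ (-1, 0) ∈ rotationSubalgebra θ := by
    have := star_mem hu
    rw [star_rotM] at this
    simpa [rotScalar_zero] using this
  have hv' : rotM θ (0, -1) ∈ rotationSubalgebra θ := by
    have := star_mem hv
    rw [star_rotM] at this
    simpa [rotScalar_zero] using this
  have h1 : ∀ a : ℤ, rotM θ (a, 0) ∈ rotationSubalgebra θ := by
    intro a
    induction a with
    | zero => exact (rotM_zero (θ := θ)) ▸ one_mem _
    | succ n ih =>
      have := mul_mem ih hu
      rw [rotM_mul] at this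
      simpa [rotScalar_zero] using this
    | pred n ih =>
      have := mul_mem ih hu'
      rw [rotM_mul] at this
      simpa [rotScalar_zero, sub_eq_add_neg] using this
  have h2 : ∀ b : ℤ, rotM θ (0, b) ∈ rotationSubalgebra θ := by
    intro a
    induction a with
    | zero => exact (rotM_zero (θ := θ)) ▸ one_mem _
    | succ n ih =>
      have := mul_mem ih hv
      rw [rotM_mul] at this
      simpa [rotScalar_zero] using this
    | pred n ih =>
      have := mul_mem ih hv'
      rw [rotM_mul] at this
      simpa [rotScalar_zero, sub_eq_add_neg] using this
  have := mul_mem (h1 g.1) (h2 g.2)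
  rw [rotM_mul] at this
  simpa [rotScalar_zero] using this

theorem span_rotM_mul_mem {y z : SqSummable →L[ℂ] SqSummable}
    (h1 : y ∈ Submodule.span ℂ (Set.range (rotM θ)))
    (h2 : z ∈ Submodule.span ℂ (Set.range (rotM θ))) :
    y * z ∈ Submodule.span ℂ (Set.range (rotM θ)) := by
  induction h1 using Submodule.span_induction with
  | zero => rw [zero_mul]; exact zero_mem _
  | add _ _ _ _ ha hb => rw [add_mul]; exact add_mem ha hb
  | smul _ _ _ ha => rw [smul_mul_assoc]; exact Submodule.smul_mem _ _ ha
  | mem y hy =>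
    obtain ⟨g, rfl⟩ := hy
    induction h2 using Submodule.span_induction with
    | zero => rw [mul_zero]; exact zero_mem _
    | add _ _ _ _ ha hb => rw [mul_add]; exact add_mem ha hb
    | smul _ _ _ ha => rw [mul_smul_comm]; exact Submodule.smul_mem _ _ ha
    | mem z hz =>
      obtain ⟨h, rfl⟩ := hz
      rw [rotM_mul]
      exact Submodule.smul_mem _ _ (Submodule.subset_span ⟨_, rfl⟩)

theorem span_rotM_star_mem {y : SqSummable →L[ℂ] SqSummable}
    (h1 : y ∈ Submodule.span ℂ (Set.range (rotM θ))) :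
    star y ∈ Submodule.span ℂ (Set.range (rotM θ)) := by
  induction h1 using Submodule.span_induction with
  | zero => rw [star_zero]; exact zero_mem _
  | add _ _ _ _ ha hb => rw [star_add]; exact add_mem ha hb
  | smul _ _ _ ha => rw [star_smul]; exact Submodule.smul_mem _ _ ha
  | mem y hy =>
    obtain ⟨g, rfl⟩ := hy
    rw [star_rotM]
    exact Submodule.smul_mem _ _ (Submodule.subset_span ⟨_, rfl⟩)

/-- `A_θ` is the closed linear span of the operators `u ^ a * v ^ b`. -/
theorem mem_closure_span_rotM {x : SqSummable →L[ℂ] SqSummable} (hx : x ∈ rotationSubalgebra θ) :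
    x ∈ closure (Submodule.span ℂ (Set.range (rotM θ)) : Set (SqSummable →L[ℂ] SqSummable)) := by
  have hx' : x ∈ closure (StarAlgebra.adjoin ℂ
      {weightedShift (fun i => Circle.exp (2 * Real.pi * θ * i.2)) (1, 0),
        weightedShift (fun _ => 1) (0, 1)} : Set (SqSummable →L[ℂ] SqSummable)) := hx
  refine closure_mono (fun y hy => ?_) hx'
  rw [← rotM_one_zero, ← rotM_zero_one] at hy
  refine StarAlgebra.adjoin_induction (p := fun y _ => y ∈ Submodule.span ℂ (Set.range (rotM θ)))
    ?_ ?_ ?_ ?_ ?_ hy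
  · rintro y (rfl | rfl) <;> exact Submodule.subset_span ⟨_, rfl⟩
  · intro z
    rw [Algebra.algebraMap_eq_smul_one, ← rotM_zero (θ := θ)]
    exact Submodule.smul_mem _ _ (Submodule.subset_span ⟨_, rfl⟩)
  · exact fun _ _ _ _ h1 h2 => add_mem h1 h2
  · exact fun _ _ _ _ h1 h2 => span_rotM_mul_mem h1 h2
  · exact fun _ _ h1 => span_rotM_star_mem h1

end RotationAlgebra

section RotationAlgebraSimple

open Filter Topology

open scoped ENNReal

variable {θ : ℝ}

/-- The vector state `x ↦ ⟨δ₀, x δ₀⟩`. -/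
noncomputable def vecState (x : SqSummable →L[ℂ] SqSummable) : ℂ :=
  inner ℂ (lp.single 2 (0 : ℤ × ℤ) (1 : ℂ)) (x (lp.single 2 0 1))

theorem vecState_eq (x : SqSummable →L[ℂ] SqSummable) :
    vecState x = x (lp.single 2 (0 : ℤ × ℤ) (1 : ℂ)) 0 := by
  rw [vecState, lp.inner_single_left]
  simp

theorem vecState_add (x y : SqSummable →L[ℂ] SqSummable) :
    vecState (x + y) = vecState x + vecState y := inner_add_right _ _ _

theorem vecState_sub (x y : SqSummable →L[ℂ] SqSummable) :
    vecState (x - y) = vecState x - vecState y := inner_sub_right _ _ _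

theorem vecState_smul (z : ℂ) (x : SqSummable →L[ℂ] SqSummable) :
    vecState (z • x) = z * vecState x := inner_smul_right _ _ _

theorem norm_single_zero : ‖(lp.single 2 (0 : ℤ × ℤ) (1 : ℂ) : SqSummable)‖ = 1 := by
  rw [lp.norm_single (by norm_num)]
  simp

theorem norm_vecState_le (x : SqSummable →L[ℂ] SqSummable) : ‖vecState x‖ ≤ ‖x‖ := by
  refine (norm_inner_le_norm _ _).trans ?_
  rw [norm_single_zero, one_mul]
  exact (x.le_opNorm _).trans (by rw [norm_single_zero, mul_one])

theorem vecState_rotM_zero : vecState (rotM θ 0) = 1 := by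
  rw [vecState_eq, rotM_zero]
  simp

theorem vecState_rotM {g : ℤ × ℤ} (hg : g ≠ 0) : vecState (rotM θ g) = 0 := by
  rw [vecState_eq, rotM, weightedShift_apply, lp.single_apply_ne, mul_zero]
  simpa using hg

/-- Averaging over conjugations by unitaries. -/
noncomputable def rotAvg (θ : ℝ) (n : ℕ) (x : SqSummable →L[ℂ] SqSummable) :
    SqSummable →L[ℂ] SqSummable :=
  ((n : ℂ)⁻¹ * (n : ℂ)⁻¹) • ∑ j ∈ Finset.range n, ∑ k ∈ Finset.range n,
    rotM θ (j, k) * x * star (rotM θ (j, k))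

theorem rotAvg_add (n : ℕ) (x y : SqSummable →L[ℂ] SqSummable) :
    rotAvg θ n (x + y) = rotAvg θ n x + rotAvg θ n y := by
  simp only [rotAvg, mul_add, add_mul, Finset.sum_add_distrib, smul_add]

theorem rotAvg_smul (n : ℕ) (z : ℂ) (x : SqSummable →L[ℂ] SqSummable) :
    rotAvg θ n (z • x) = z • rotAvg θ n x := by
  simp only [rotAvg, mul_smul_comm, smul_mul_assoc, ← Finset.smul_sum]
  rw [smul_comm]

theorem rotAvg_sub (n : ℕ) (x y : SqSummable →L[ℂ] SqSummable) :
    rotAvg θ n (x - y) = rotAvg θ n x - rotAvg θ n y := by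
  rw [sub_eq_add_neg, ← neg_one_smul ℂ y, rotAvg_add, rotAvg_smul, neg_one_smul, sub_eq_add_neg]

theorem norm_rotM_le (g : ℤ × ℤ) : ‖rotM θ g‖ ≤ 1 :=
  LinearIsometry.norm_toContinuousLinearMap_le _

theorem norm_rotAvg_le (n : ℕ) (x : SqSummable →L[ℂ] SqSummable) : ‖rotAvg θ n x‖ ≤ ‖x‖ := by
  rcases Nat.eq_zero_or_pos n with rfl | hn
  · simp [rotAvg]
  have h1 : ∀ j k : ℕ, ‖rotM θ (j, k) * x * star (rotM θ (j, k))‖ ≤ ‖x‖ := by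
    intro j k
    calc _ ≤ ‖rotM θ (j, k)‖ * ‖x‖ * ‖star (rotM θ (j, k))‖ :=
          (norm_mul_le _ _).trans (mul_le_mul_of_nonneg_right (norm_mul_le _ _) (norm_nonneg _))
      _ ≤ 1 * ‖x‖ * 1 := by
          have hst : ‖star (rotM θ (j, k))‖ ≤ 1 := by
            rw [star_rotM, norm_smul, norm_rotScalar, one_mul]
            exact norm_rotM_le _
          gcongr
          exact norm_rotM_le _
      _ = ‖x‖ := by ring
  have h2 : ‖∑ j ∈ Finset.range n, ∑ k ∈ Finset.range n,
      rotM θ (j, k) * x * star (rotM θ (j, k))‖ ≤ n * (n * ‖x‖) := by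
    refine (norm_sum_le_of_le _ fun j _ => (norm_sum_le_of_le _ fun k _ => h1 j k)).trans ?_
    simp
  rw [rotAvg, norm_smul, norm_mul, norm_inv, Complex.norm_natCast]
  have hn' : (0 : ℝ) < n := Nat.cast_pos.2 hn
  calc _ ≤ (n : ℝ)⁻¹ * (n : ℝ)⁻¹ * (n * (n * ‖x‖)) := by gcongr
    _ = ‖x‖ := by field_simp

/-- Averages of powers of a complex number. -/
noncomputable def powAvg (n : ℕ) (z : ℂ) : ℂ := (n : ℂ)⁻¹ * ∑ j ∈ Finset.range n, z ^ j

theorem tendsto_powAvg_one : Tendsto (fun n => powAvg n 1) atTop (𝓝 1) := by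
  refine tendsto_const_nhds.congr' ?_
  filter_upwards [eventually_gt_atTop 0] with n hn
  have : (n : ℂ) ≠ 0 := Nat.cast_ne_zero.2 hn.ne'
  simp [powAvg, this]

theorem tendsto_powAvg {z : ℂ} (hz : ‖z‖ = 1) (h : z ≠ 1) :
    Tendsto (fun n => powAvg n z) atTop (𝓝 0) := by
  have h0 : Tendsto (fun n : ℕ => (n : ℝ)⁻¹ * (2 / ‖z - 1‖)) atTop (𝓝 0) := by
    simpa using tendsto_inv_atTop_nhds_zero_nat.mul_const (2 / ‖z - 1‖)
  refine squeeze_zero_norm (fun n => ?_) h0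
  rw [powAvg, geom_sum_eq h, norm_mul, norm_inv, Complex.norm_natCast, norm_div]
  gcongr
  refine (norm_sub_le _ _).trans ?_
  rw [norm_pow, hz, one_pow, norm_one]
  norm_num

theorem rotScalar_natCast_mul (j : ℕ) (m : ℤ) : rotScalar θ (j * m) = rotScalar θ m ^ j := by
  induction j with
  | zero => simp [rotScalar_zero]
  | succ j ih => rw [pow_succ, ← ih, ← rotScalar_add]; push_cast; ring_nf

theorem rotAvg_rotM (n : ℕ) (g : ℤ × ℤ) : rotAvg θ n (rotM θ g)
    = (powAvg n (rotScalar θ g.2) * powAvg n (rotScalar θ (-g.1))) • rotM θ g := by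
  have h1 : ∀ j k : ℕ, rotM θ (j, k) * rotM θ g * star (rotM θ (j, k))
      = (rotScalar θ g.2 ^ j * rotScalar θ (-g.1) ^ k) • rotM θ g := by
    intro j k
    rw [rotM_comm, smul_mul_assoc, mul_assoc, rotM_mul_star, mul_one, ← rotScalar_natCast_mul,
      ← rotScalar_natCast_mul, ← rotScalar_add]
    congr 2
    ring
  simp only [rotAvg, powAvg, h1, ← Finset.sum_smul, ← Finset.mul_sum, ← Finset.sum_mul, smul_smul]
  congr 1
  ring

theorem tendsto_rotAvg_rotM (hθ : Irrational θ) (g : ℤ × ℤ) :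
    Tendsto (fun n => rotAvg θ n (rotM θ g)) atTop (𝓝 (vecState (rotM θ g) • 1)) := by
  simp only [rotAvg_rotM]
  by_cases hg : g = 0
  · subst hg
    have h := (tendsto_powAvg_one.mul tendsto_powAvg_one).smul_const
      (1 : SqSummable →L[ℂ] SqSummable)
    rw [vecState_rotM_zero]
    simpa [rotScalar_zero, rotM_zero] using h
  rw [vecState_rotM hg, zero_smul, ← zero_smul ℂ (rotM θ g)]
  refine Tendsto.smul_const ?_ _
  have key : ∀ k : ℤ, ∃ a : ℂ, Tendsto (fun n => powAvg n (rotScalar θ k)) atTop (𝓝 a) ∧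
      (k ≠ 0 → a = 0) := by
    intro k
    by_cases hk : k = 0
    · exact ⟨1, by rw [hk, rotScalar_zero]; exact tendsto_powAvg_one, fun h => (h hk).elim⟩
    · exact ⟨0, tendsto_powAvg (norm_rotScalar _) (rotScalar_ne_one hθ hk), fun _ => rfl⟩
  obtain ⟨a, ha, ha'⟩ := key g.2
  obtain ⟨b, hb, hb'⟩ := key (-g.1)
  have hab : a * b = 0 := by
    by_cases h2 : g.2 = 0
    · rw [hb' (neg_ne_zero.2 fun h1 => hg (Prod.ext h1 h2)), mul_zero]
    · rw [ha' h2, zero_mul]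
  rw [← hab]
  exact ha.mul hb

theorem tendsto_rotAvg (hθ : Irrational θ) {x : SqSummable →L[ℂ] SqSummable}
    (hx : x ∈ rotationSubalgebra θ) :
    Tendsto (fun n => rotAvg θ n x) atTop (𝓝 (vecState x • 1)) := by
  have hspan : ∀ y ∈ Submodule.span ℂ (Set.range (rotM θ)),
      Tendsto (fun n => rotAvg θ n y) atTop (𝓝 (vecState y • 1)) := by
    intro y hy
    induction hy using Submodule.span_induction with
    | mem y hy => obtain ⟨g, rfl⟩ := hy; exact tendsto_rotAvg_rotM hθ g
    | zero =>
      have h : vecState 0 = 0 := by simp [vecState]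
      simp [h, rotAvg]
    | add y z _ _ h1 h2 =>
      simp only [rotAvg_add, vecState_add, add_smul]
      exact h1.add h2
    | smul c y _ h1 =>
      simp only [rotAvg_smul, vecState_smul, mul_smul]
      exact h1.const_smul c
  rw [Metric.tendsto_atTop]
  intro ε hε
  obtain ⟨y, hy, hxy⟩ := Metric.mem_closure_iff.1 (mem_closure_span_rotM hx) (ε / 3) (by linarith)
  obtain ⟨N, hN⟩ := Metric.tendsto_atTop.1 (hspan y hy) (ε / 3) (by linarith)
  refine ⟨N, fun n hn => ?_⟩
  have h1 := hN n hn
  rw [dist_eq_norm] at hxy h1 ⊢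
  have h2 : rotAvg θ n x - vecState x • (1 : SqSummable →L[ℂ] SqSummable)
      = rotAvg θ n (x - y) + (rotAvg θ n y - vecState y • 1) - vecState (x - y) • 1 := by
    rw [rotAvg_sub, vecState_sub, sub_smul]
    abel
  have h3 : ‖vecState (x - y) • (1 : SqSummable →L[ℂ] SqSummable)‖ ≤ ‖x - y‖ := by
    rw [norm_smul]
    exact (mul_le_of_le_one_right (norm_nonneg _) ContinuousLinearMap.norm_id_le).trans
      (norm_vecState_le _)
  rw [h2]
  calc _ ≤ ‖rotAvg θ n (x - y)‖ + ‖rotAvg θ n y - vecState y • 1‖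
        + ‖vecState (x - y) • (1 : SqSummable →L[ℂ] SqSummable)‖ :=
        (norm_sub_le _ _).trans (add_le_add_left (norm_add_le _ _) _)
    _ < ε / 3 + ε / 3 + ε / 3 :=
        add_lt_add (add_lt_add ((norm_rotAvg_le _ _).trans_lt hxy) h1) (h3.trans_lt hxy)
    _ = ε := by ring

theorem rotR_comm (g : ℤ × ℤ) {x : SqSummable →L[ℂ] SqSummable}
    (hx : x ∈ rotationSubalgebra θ) : rotR θ g * x = x * rotR θ g := by
  have hcl : IsClosed {y : SqSummable →L[ℂ] SqSummable | rotR θ g * y = y * rotR θ g} :=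
    isClosed_eq (continuous_const_mul _) (continuous_mul_const _)
  refine closure_minimal (fun y hy => ?_) hcl (mem_closure_span_rotM hx)
  change rotR θ g * y = y * rotR θ g
  induction hy using Submodule.span_induction with
  | mem y hy => obtain ⟨h, rfl⟩ := hy; exact rotR_comm_rotM g h
  | zero => rw [mul_zero, zero_mul]
  | add y z _ _ h1 h2 => rw [mul_add, add_mul, h1, h2]
  | smul c y _ h1 => rw [mul_smul_comm, smul_mul_assoc, h1]

theorem vecState_ne_zero {q : SqSummable →L[ℂ] SqSummable} (hmem : q ∈ rotationSubalgebra θ)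
    (hq : IsStarProjection q) (h0 : q ≠ 0) : vecState q ≠ 0 := by
  intro h
  apply h0
  have h1 : q (lp.single 2 (0 : ℤ × ℤ) (1 : ℂ)) = 0 := by
    rw [vecState, ← hq.isIdempotentElem.eq] at h
    have h2 := ContinuousLinearMap.adjoint_inner_left q (q (lp.single 2 (0 : ℤ × ℤ) (1 : ℂ)))
      (lp.single 2 (0 : ℤ × ℤ) (1 : ℂ))
    rw [← ContinuousLinearMap.star_eq_adjoint, hq.isSelfAdjoint.star_eq] at h2
    exact inner_self_eq_zero.1 (h2.trans h)
  have h2 : ∀ (g : ℤ × ℤ) (z : ℂ), q (lp.single 2 g z) = 0 := by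
    intro g z
    let c : Circle := Circle.exp (2 * Real.pi * θ * (g.2 * g.1))
    have h3 : (lp.single 2 g z : SqSummable)
        = (z * (c : ℂ)⁻¹) • rotR θ g (lp.single 2 (0 : ℤ × ℤ) (1 : ℂ)) := by
      ext i
      have h4 : ((z * (c : ℂ)⁻¹) • rotR θ g (lp.single 2 (0 : ℤ × ℤ) (1 : ℂ))) i
        = z * (c : ℂ)⁻¹ * rotR θ g (lp.single 2 (0 : ℤ × ℤ) (1 : ℂ)) i := rfl
      rw [h4, rotR, weightedShift_apply]
      by_cases hi : i = g
      · subst hi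
        rw [sub_self, lp.single_apply_self, lp.single_apply_self, mul_one, mul_assoc,
          inv_mul_cancel₀ (Circle.coe_ne_zero c), mul_one]
      · rw [lp.single_apply_ne _ _ _ hi, lp.single_apply_ne _ _ _ (sub_ne_zero.2 hi), mul_zero,
          mul_zero]
    have h5 : q (rotR θ g (lp.single 2 (0 : ℤ × ℤ) (1 : ℂ))) = 0 := by
      have h6 := congrArg (fun T => T (lp.single 2 (0 : ℤ × ℤ) (1 : ℂ))) (rotR_comm g hmem)
      exact h6.symm.trans ((congrArg (rotR θ g) h1).trans (map_zero _))
    rw [h3, map_smul, h5, smul_zero]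
  ext1 f
  have h3 := (lp.hasSum_single (p := 2) (by norm_num) f).mapL q
  simp only [h2] at h3
  exact h3.unique hasSum_zero

/-- If `θ` is irrational, then every nonzero projection of `A_θ` is full. -/
theorem isFullProjection_rotationAlgebra (hθ : Irrational θ) {q : RotationAlgebra θ}
    (hq : IsStarProjection q) (h0 : q ≠ 0) : IsFullProjection q := by
  set I := Submodule.span ℂ {x : RotationAlgebra θ | ∃ a b, a * q * b = x}
  have hq' : IsStarProjection (q : SqSummable →L[ℂ] SqSummable) :=
    ⟨congrArg Subtype.val hq.isIdempotentElem, congrArg Subtype.val hq.isSelfAdjoint⟩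
  have hs := vecState_ne_zero q.2 hq' (fun h => h0 (Subtype.ext h))
  let M : ℤ × ℤ → RotationAlgebra θ := fun g => ⟨rotM θ g, rotM_mem g⟩
  let T : ℕ → RotationAlgebra θ := fun n => ((n : ℂ)⁻¹ * (n : ℂ)⁻¹) •
    ∑ j ∈ Finset.range n, ∑ k ∈ Finset.range n, M (j, k) * q * star (M (j, k))
  have hT : ∀ n, T n ∈ I := fun n => Submodule.smul_mem _ _ <| sum_mem fun j _ =>
    sum_mem fun k _ => Submodule.subset_span ⟨_, _, rfl⟩
  have hlim : Tendsto T atTop (𝓝 (vecState (q : SqSummable →L[ℂ] SqSummable) • 1)) := by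
    rw [tendsto_subtype_rng]
    refine (tendsto_rotAvg hθ q.2).congr fun n => ?_
    simp only [T, M, rotAvg]
    push_cast
    rfl
  have h1 : (1 : RotationAlgebra θ) ∈ I.topologicalClosure := by
    have h2 : vecState (q : SqSummable →L[ℂ] SqSummable) • (1 : RotationAlgebra θ)
        ∈ I.topologicalClosure := mem_closure_of_tendsto hlim (Eventually.of_forall hT)
    have h3 := I.topologicalClosure.smul_mem
      (vecState (q : SqSummable →L[ℂ] SqSummable))⁻¹ h2
    rwa [smul_smul, inv_mul_cancel₀ hs, one_smul] at h3
  intro a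
  have h4 : a * 1 ∈ closure (I : Set (RotationAlgebra θ)) := by
    refine map_mem_closure (continuous_const_mul a) h1 fun y hy => ?_
    change a * y ∈ I
    induction hy using Submodule.span_induction with
    | mem y hy =>
      obtain ⟨b, c, rfl⟩ := hy
      exact Submodule.subset_span ⟨a * b, c, by simp only [mul_assoc]⟩
    | zero => rw [mul_zero]; exact zero_mem _
    | add y z _ _ h1 h2 => rw [mul_add]; exact add_mem h1 h2
    | smul c y _ h1 => rw [mul_smul_comm]; exact Submodule.smul_mem _ _ h1
  rwa [mul_one] at h4

end RotationAlgebraSimple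

section RealMultiplication

variable {A : Type u} [CStarAlgebra A] {q₁ q₂ : A} {h₁ : IsStarProjection q₁}
  {h₂ : IsStarProjection q₂}

theorem isStarProjection_cornerEquiv (φ : A ≃⋆ₐ[ℂ] corner h₂) (h₁ : IsStarProjection q₁) :
    IsStarProjection (φ q₁ : A) :=
  ⟨by
    have h := congrArg (fun x => (φ x : A)) h₁.isIdempotentElem.eq
    rw [map_mul] at h
    exact h, by
    have h := congrArg (fun x => (φ x : A)) h₁.isSelfAdjoint.star_eq
    rw [map_star] at h
    exact h⟩

theorem comp_mem_corner (φ₁ : A ≃⋆ₐ[ℂ] corner h₁) (φ₂ : A ≃⋆ₐ[ℂ] corner h₂) (a : A) :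
    (φ₂ (φ₁ a) : A) ∈ corner (isStarProjection_cornerEquiv φ₂ h₁) :=
  ⟨by
    have h := congrArg (fun x => (φ₂ x : A)) (φ₁ a).2.1
    rw [map_mul] at h
    exact h, by
    have h := congrArg (fun x => (φ₂ x : A)) (φ₁ a).2.2
    rw [map_mul] at h
    exact h⟩

theorem mem_corner_of_mem_corner (φ : A ≃⋆ₐ[ℂ] corner h₂) {y : A}
    (hy : (φ q₁ : A) * y = y ∧ y * φ q₁ = y) : y ∈ corner h₂ :=
  ⟨by rw [← hy.1, ← mul_assoc, (φ q₁).2.1], by rw [← hy.2, mul_assoc, (φ q₁).2.2]⟩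

theorem symm_mem_corner (φ : A ≃⋆ₐ[ℂ] corner h₂) {y : A}
    (hy : (φ q₁ : A) * y = y ∧ y * φ q₁ = y) :
    φ.symm ⟨y, mem_corner_of_mem_corner φ hy⟩ ∈ corner h₁ := by
  have e := congrArg Subtype.val (φ.apply_symm_apply ⟨y, mem_corner_of_mem_corner φ hy⟩)
  constructor <;> refine EquivLike.injective φ (Subtype.ext ?_)
  · have h := map_mul φ q₁ (φ.symm ⟨y, mem_corner_of_mem_corner φ hy⟩)
    rw [φ.apply_symm_apply] at h
    exact (congrArg Subtype.val h).trans
      (hy.1.trans e.symm)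
  · have h := map_mul φ (φ.symm ⟨y, mem_corner_of_mem_corner φ hy⟩) q₁
    rw [φ.apply_symm_apply] at h
    exact (congrArg Subtype.val h).trans
      (hy.2.trans e.symm)

/-- The composition `φ₂ ∘ φ₁`, as an isomorphism from `A` onto the corner of the projection
`φ₂ q₁`. -/
noncomputable def cornerComp (φ₁ : A ≃⋆ₐ[ℂ] corner h₁) (φ₂ : A ≃⋆ₐ[ℂ] corner h₂) :
    A ≃⋆ₐ[ℂ] corner (isStarProjection_cornerEquiv φ₂ h₁) where
  toFun a := ⟨φ₂ (φ₁ a), comp_mem_corner φ₁ φ₂ a⟩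
  invFun y := φ₁.symm ⟨φ₂.symm ⟨y, mem_corner_of_mem_corner φ₂ y.2⟩, symm_mem_corner φ₂ y.2⟩
  left_inv a := cornerEquiv_symm_eq φ₁ _ a (cornerEquiv_symm_eq φ₂ _ (φ₁ a : A) rfl)
  right_inv y := by
    apply Subtype.ext
    change (φ₂ (φ₁ (φ₁.symm ⟨φ₂.symm ⟨y, mem_corner_of_mem_corner φ₂ y.2⟩,
      symm_mem_corner φ₂ y.2⟩)) : A) = y
    rw [φ₁.apply_symm_apply]
    exact congrArg Subtype.val (φ₂.apply_symm_apply ⟨y, mem_corner_of_mem_corner φ₂ y.2⟩)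
  map_mul' a b := Subtype.ext <| by
    change (φ₂ (φ₁ (a * b)) : A) = φ₂ (φ₁ a) * φ₂ (φ₁ b)
    rw [map_mul]
    exact congrArg Subtype.val (map_mul φ₂ (φ₁ a : A) (φ₁ b))
  map_add' a b := Subtype.ext <| by
    change (φ₂ (φ₁ (a + b)) : A) = φ₂ (φ₁ a) + φ₂ (φ₁ b)
    rw [map_add]
    exact congrArg Subtype.val (map_add φ₂ (φ₁ a : A) (φ₁ b))
  map_star' a := Subtype.ext <| by
    change (φ₂ (φ₁ (star a)) : A) = star (φ₂ (φ₁ a) : A)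
    rw [map_star]
    exact congrArg Subtype.val (map_star φ₂ (φ₁ a : A))
  map_smul' z a := Subtype.ext <| by
    change (φ₂ (φ₁ (z • a)) : A) = z • (φ₂ (φ₁ a) : A)
    rw [map_smul]
    exact congrArg Subtype.val (map_smul φ₂ z (φ₁ a : A))

theorem ne_zero_of_cornerEquiv [Nontrivial A] (φ : A ≃⋆ₐ[ℂ] corner h₁) : q₁ ≠ 0 := by
  intro h
  apply one_ne_zero (α := A)
  apply φ.injective
  rw [map_zero]
  exact Subtype.ext ((cornerEquiv_one φ).trans h)

variable {θ : ℝ} {q : RotationAlgebra θ} {hq : IsStarProjection q}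

theorem isFullProjection_of_cornerEquiv (hθ : Irrational θ)
    (φ : RotationAlgebra θ ≃⋆ₐ[ℂ] corner hq) : IsFullProjection q := by
  have : Nontrivial (RotationAlgebra θ) := by
    refine ⟨⟨0, 1, fun h => ?_⟩⟩
    have h1 := congrArg (fun x : RotationAlgebra θ => vecState (x : SqSummable →L[ℂ] SqSummable)) h
    have h2 := vecState_rotM_zero (θ := θ)
    rw [rotM_zero] at h2
    have h3 : vecState 0 = 0 := by simp [vecState]
    exact zero_ne_one (h3.symm.trans (h1.trans h2))
  exact isFullProjection_rotationAlgebra hθ hq (ne_zero_of_cornerEquiv φ)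

/-- The `A_θ`-`A_θ`-equivalence bimodule `E_{θ,φ,q}`: the space `q A_θ` with the obvious right
`A_θ`-action and right inner product, and with `a • x = φ a * x` and left inner product
`φ⁻¹ (x y⋆)`. -/
noncomputable def realMultE (hθ : Irrational θ) (φ : RotationAlgebra θ ≃⋆ₐ[ℂ] corner hq) :
    EquivBimodule.{0} (RotationAlgebra θ) (RotationAlgebra θ) :=
  rightIdealBimodule (isFullProjection_of_cornerEquiv hθ φ) φ

/-- The `A_θ`-`A_θ`-equivalence bimodule `F_{θ,φ,q}`: the space `A_θ q` with the obvious left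
`A_θ`-action and left inner product, and with `x <• a = x * φ a` and right inner product
`φ⁻¹ (x⋆ y)`. -/
noncomputable def realMultF (hθ : Irrational θ) (φ : RotationAlgebra θ ≃⋆ₐ[ℂ] corner hq) :
    EquivBimodule.{0} (RotationAlgebra θ) (RotationAlgebra θ) :=
  leftIdealBimodule (isFullProjection_of_cornerEquiv hθ φ) φ

end RealMultiplication

/-! All three isomorphisms come from multiplication in `A`. On elementary tensors they are `x ⊗ y ↦
φ₂(x) y` for `q₁A ⊗ q₂A → φ₂(q₁)A`, `x ⊗ y ↦ φ⁻¹(x y)` for `qA ⊗ Aq → A`, and `x ⊗ y ↦ x y` for `Aq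
⊗ qA → A`. Each carries the two inner products of the tensor product to those of the target: after
the adjoint of a product is expanded, every `φ⁻¹` inside the tensor inner product meets the `φ` of
an action and cancels. The twist by `φ₂` in the first map explains the order of composition: `φ₁(a)
x ⊗ y` goes to `φ₂(φ₁(a)) φ₂(x) y`.

Nothing more than inner products and density has to be checked. By `completion_isomorphic`, a linear
map that preserves inner products is isometric, so it extends to the completion with closed range,
and a dense image makes the extension bijective. Compatibility with both actions is then automatic,
because a vector is determined by its inner products and these are linear over the algebras.
`tensor_isomorphic` reduces the check further, to elementary tensors. The first two maps are already
onto before completion; for `Aq ⊗ qA` the values `a q b` span a dense ideal because `q` is full,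
which holds for nonzero projections when `θ` is irrational.

The trace formula follows from uniqueness of the trace. The functional `a ↦ τ_θ(φ₂(a))` is a bounded
trace on `A_θ` with value `τ_θ(q₂)` at `1`, so it equals `τ_θ(q₂) τ_θ`; evaluating it at `q₁` gives
the claim. Uniqueness (`eq_rotationTrace_mul`) is an averaging argument: the means of `M a M⋆` over
the unitaries `M = rotM θ (j, k)` with `0 ≤ j, k < n` tend in norm to `τ_θ(a) 1`, whereas any trace
takes the same value on all of these means as on `a`. That `τ_θ` is itself a trace
(`vecState_mul_comm`) is checked on the operators `rotM θ g`, whose span is dense. -/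

/-! ### Cauchy–Schwarz, continuity and nondegeneracy of the inner products -/

namespace EquivBimodule

variable {A : Type v} {B : Type w} [CStarAlgebra A] [CStarAlgebra B] (G : EquivBimodule.{u} A B)

/-- Imprimitivity gives `⟨η, ξ⟩⟨ξ, η⟩ = ⟨η, a • η⟩` with `a` the positive element `linner ξ ξ`.
Hence `‖⟨ξ, η⟩‖²` is at most `‖a‖ ‖⟨η, η⟩‖`, and both inner products define the norm of the module.
-/
theorem norm_rinner_le (ξ η : G.carrier) : ‖G.rinner ξ η‖ ≤ ‖ξ‖ * ‖η‖ := by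
  refine le_of_sq_le_sq ?_ (mul_nonneg (norm_nonneg ξ) (norm_nonneg η))
  rw [mul_pow, ← G.norm_linner_self ξ, ← G.norm_rinner_self η]
  exact G.toPre.norm_rinner_sq_le ξ η

theorem norm_linner_le (ξ η : G.carrier) : ‖G.linner ξ η‖ ≤ ‖ξ‖ * ‖η‖ := by
  refine le_of_sq_le_sq ?_ (mul_nonneg (norm_nonneg ξ) (norm_nonneg η))
  rw [mul_pow, ← G.norm_linner_self ξ, ← G.norm_rinner_self η, mul_comm]
  exact G.toPre.norm_linner_sq_le ξ η

/-- Continuity in each variable separately is enough for what follows: identities between inner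
products are extended from a dense subspace one variable at a time. -/
theorem continuous_rinner_right (ξ : G.carrier) : Continuous (G.rinner ξ) :=
  AddMonoidHomClass.continuous_of_bound (AddMonoidHom.mk' (G.rinner ξ) (G.rinner_add_right ξ)) ‖ξ‖
    (G.norm_rinner_le ξ)

theorem continuous_linner_left (η : G.carrier) : Continuous (G.linner · η) :=
  AddMonoidHomClass.continuous_of_bound
    (AddMonoidHom.mk' (G.linner · η) fun ξ ζ => G.linner_add_left ξ ζ η) ‖η‖
    fun ξ => (G.norm_linner_le ξ η).trans_eq (mul_comm _ _)

theorem continuous_rinner_left (η : G.carrier) : Continuous (G.rinner · η) := by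
  simp_rw [← G.star_rinner η]
  exact (G.continuous_rinner_right η).star

theorem continuous_linner_right (ξ : G.carrier) : Continuous (G.linner ξ) := by
  have h : G.linner ξ = fun η => star (G.linner η ξ) := funext fun η => (G.star_linner η ξ).symm
  rw [h]
  exact (G.continuous_linner_left ξ).star

variable {G}

/-- Expanding `⟨ξ - η, ξ - η⟩` leaves only terms that the hypothesis at `ζ = ξ` and `ζ = η` cancels
in pairs, so `ξ - η` has norm zero. This and its left-handed counterpart turn preservation of inner
products into preservation of the actions. -/
theorem ext_rinner {ξ η : G.carrier} (h : ∀ ζ, G.rinner ζ ξ = G.rinner ζ η) : ξ = η := by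
  rw [← sub_eq_zero, ← norm_eq_zero, ← sq_eq_zero_iff, ← G.norm_rinner_self, norm_eq_zero]
  refine (G.toPre.rinner_sub_self ξ η).trans ?_
  change G.rinner ξ ξ + G.rinner η η - (G.rinner ξ η + G.rinner η ξ) = 0
  rw [h ξ, h η, sub_self]

theorem ext_linner {ξ η : G.carrier} (h : ∀ ζ, G.linner ξ ζ = G.linner η ζ) : ξ = η := by
  rw [← sub_eq_zero, ← norm_eq_zero, ← sq_eq_zero_iff, ← G.norm_linner_self, norm_eq_zero]
  refine (G.toPre.linner_sub_self ξ η).trans ?_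
  change G.linner ξ ξ + G.linner η η - (G.linner ξ η + G.linner η ξ) = 0
  rw [h ξ, h η, add_comm, sub_self]

end EquivBimodule

/-! ### Isomorphisms out of a completion -/

namespace PreEquivBimodule

variable {A : Type v} {B : Type w} [CStarAlgebra A] [CStarAlgebra B]
  {P : PreEquivBimodule.{u} A B} {G : EquivBimodule.{u} A B}

open UniformSpace.Completion in
/-- A linear map with dense range from `P` to an equivalence bimodule which preserves both inner
products extends to an isomorphism from the completion of `P`. -/
theorem completion_isomorphic (T : P.carrier →ₗ[ℂ] G.carrier)
    (hl : ∀ ξ η, G.linner (T ξ) (T η) = P.linner ξ η)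
    (hr : ∀ ξ η, G.rinner (T ξ) (T η) = P.rinner ξ η) (hT : DenseRange T) :
    P.completion.Isomorphic G := by
  -- Both norms are square roots of norms of right inner products, so `T` is isometric for the
  -- seminorm of `P`; vectors of length zero are therefore killed and `T` descends to the
  -- completion.
  have hnorm : ∀ ξ, ‖T ξ‖ = ‖ξ‖ := fun ξ => by
    rw [← sq_eq_sq₀ (norm_nonneg _) (norm_nonneg _), ← G.norm_rinner_self, hr, ← P.norm_sq]
  let T₀ : P.carrier →L[ℂ] G.carrier := T.mkContinuous 1 fun ξ => by rw [hnorm, one_mul]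
  let S : UniformSpace.Completion P.carrier →L[ℂ] G.carrier := T₀.extend toComplL
  have hS : ∀ ξ : P.carrier, S ξ = T ξ := fun ξ =>
    T₀.extend_eq denseRange_coe (isUniformInducing_coe P.carrier) ξ
  have hiso : Isometry S := AddMonoidHomClass.isometry_of_norm S fun ξ => by
    refine induction_on ξ (isClosed_eq S.continuous.norm continuous_norm) fun ξ => ?_
    rw [hS, hnorm, norm_coe]
  -- An isometry from a complete space has closed range, and the range of `S` contains the dense
  -- range of `T`.
  have hsurj : Function.Surjective S := by
    have h1 : DenseRange S := hT.mono <| by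
      rintro _ ⟨ξ, rfl⟩
      exact ⟨ξ, hS ξ⟩
    exact fun ζ => (hiso.isClosedEmbedding.isClosed_range.closure_eq ▸ h1 ζ :)
  -- Density is used twice, first for `ξ` with `η` fixed, then for `η` with `ξ` already in `P`.
  have hSl : ∀ ξ η, G.linner (S ξ) (S η) = P.completion.linner ξ η := fun ξ η => by
    refine induction_on ξ (isClosed_eq ((G.continuous_linner_left _).comp S.continuous)
      (P.completion.continuous_linner_left η)) fun ξ => ?_
    refine induction_on η (isClosed_eq ((G.continuous_linner_right _).comp S.continuous)
      (P.completion.continuous_linner_right (ξ : UniformSpace.Completion P.carrier))) fun η => ?_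
    rw [hS, hS, hl]
    exact (P.lext_coe ξ η).symm
  have hSr : ∀ ξ η, G.rinner (S ξ) (S η) = P.completion.rinner ξ η := fun ξ η => by
    refine induction_on ξ (isClosed_eq ((G.continuous_rinner_left _).comp S.continuous)
      (P.completion.continuous_rinner_left η)) fun ξ => ?_
    refine induction_on η (isClosed_eq ((G.continuous_rinner_right _).comp S.continuous)
      (P.completion.continuous_rinner_right (ξ : UniformSpace.Completion P.carrier))) fun η => ?_
    rw [hS, hS, hr]
    exact (P.rext_coe ξ η).symm
  let e : P.completion.carrier ≃ₗ[ℂ] G.carrier :=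
    LinearEquiv.ofBijective (S : UniformSpace.Completion P.carrier →ₗ[ℂ] G.carrier)
      ⟨hiso.injective, hsurj⟩
  refine ⟨{ e with map_left := fun a ξ => ?_, map_right := fun b ξ => ?_,
                   map_linner := hSl, map_rinner := hSr }⟩
  -- Linearity over `A` is not assumed of `T`. For every `ζ`, both `S (a • ξ)` and `a • S ξ` have
  -- left inner product `a * linner ξ ζ` with `S ζ`. As `S` is onto, these inner products determine
  -- the vector.
  · refine EquivBimodule.ext_linner fun ζ => ?_
    obtain ⟨ζ, rfl⟩ := hsurj ζ
    rw [G.linner_smul_left]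
    exact (hSl _ _).trans ((P.completion.linner_smul_left a ξ ζ).trans
      (congrArg (a * ·) (hSl ξ ζ).symm))
  -- The same argument with the right inner product, which is linear over `B` in its second
  -- variable.
  · refine EquivBimodule.ext_rinner fun ζ => ?_
    obtain ⟨ζ, rfl⟩ := hsurj ζ
    rw [G.rinner_smul_right]
    exact (hSr _ _).trans ((P.completion.rinner_smul_right b ζ ξ).trans
      (congrArg (· * b) (hSr ζ ξ).symm))

end PreEquivBimodule

/-! ### Isomorphisms out of an interior tensor product -/

namespace EquivBimodule

variable {A B C : Type v} [CStarAlgebra A] [CStarAlgebra B] [CStarAlgebra C]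
  {E : EquivBimodule.{u} A B} {F : EquivBimodule.{u} B C} {G : EquivBimodule.{u} A C}

/-- A bilinear map `E × F → G` whose values span a dense subspace and which is compatible with the
inner products of `E ⊗ F` and `G` identifies `E ⊗ F` with `G`. -/
theorem tensor_isomorphic (f : E.carrier →ₗ[ℂ] F.carrier →ₗ[ℂ] G.carrier)
    (hl : ∀ x y x' y', G.linner (f x y) (f x' y') = E.linner (x <• F.linner y y') x')
    (hr : ∀ x y x' y', G.rinner (f x y) (f x' y') = F.rinner y (E.rinner x x' • y'))
    (hf : Dense (Submodule.span ℂ {z | ∃ x y, f x y = z} : Set G.carrier)) :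
    (E.tensor F).Isomorphic G := by
  let T : PreTensor E F →ₗ[ℂ] G.carrier := PreTensor.lift f
  have hT : ∀ x y, T (PreTensor.tmul x y) = f x y := fun x y => rfl
  refine PreEquivBimodule.completion_isomorphic (P := E.preTensor F) T
    (fun (s t : PreTensor E F) => ?_) (fun (s t : PreTensor E F) => ?_) ?_
  -- Elementary tensors generate the algebraic tensor product additively, so additivity in both
  -- variables reduces the identity to them.
  · change G.linner (T s) (T t) = PreTensor.lform E F s t
    induction s using PreTensor.induction with
    | hadd s₁ s₂ h₁ h₂ => rw [map_add, G.linner_add_left, h₁, h₂, PreTensor.lform_add_left]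
    | h x y =>
    induction t using PreTensor.induction with
    | hadd t₁ t₂ h₁ h₂ => rw [map_add, G.linner_add_right, h₁, h₂, PreTensor.lform_add_right]
    | h x' y' => rw [hT, hT, hl, PreTensor.lform_tmul]
  · change G.rinner (T s) (T t) = PreTensor.rform E F s t
    induction s using PreTensor.induction with
    | hadd s₁ s₂ h₁ h₂ => rw [map_add, G.rinner_add_left, h₁, h₂, PreTensor.rform_add_left]
    | h x y =>
    induction t using PreTensor.induction with
    | hadd t₁ t₂ h₁ h₂ => rw [map_add, G.rinner_add_right, h₁, h₂, PreTensor.rform_add_right]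
    | h x' y' => rw [hT, hT, hr, PreTensor.rform_tmul]
  -- The range of `T` is a subspace containing every value of `f`, hence also their span.
  · refine hf.mono ?_
    change ((Submodule.span ℂ _ : Submodule ℂ G.carrier) : Set G.carrier) ⊆ Set.range T
    rw [← LinearMap.coe_range, SetLike.coe_subset_coe, Submodule.span_le]
    rintro _ ⟨x, y, rfl⟩
    exact ⟨_, hT x y⟩

end EquivBimodule

/-! ### The three multiplication maps on `qA` and `Aq` -/

section Corner

variable {A : Type u} [CStarAlgebra A] {q₁ q₂ : A} {h₁ : IsStarProjection q₁}
  {h₂ : IsStarProjection q₂}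

/-- The isomorphism `q₁A ⊗ q₂A ≅ φ₂(q₁)A`, given by `x ⊗ y ↦ φ₂(x) y`. -/
theorem rightIdealBimodule_tensor_isomorphic (hf₁ : IsFullProjection q₁)
    (hf₂ : IsFullProjection q₂) (φ₁ : A ≃⋆ₐ[ℂ] corner h₁) (φ₂ : A ≃⋆ₐ[ℂ] corner h₂)
    (hf : IsFullProjection (φ₂ q₁ : A)) :
    ((rightIdealBimodule hf₁ φ₁).tensor (rightIdealBimodule hf₂ φ₂)).Isomorphic
      (rightIdealBimodule hf (cornerComp φ₁ φ₂)) := by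
  have hmul : ∀ a b, (φ₂ (a * b) : A) = φ₂ a * φ₂ b := fun a b =>
    congrArg Subtype.val (map_mul φ₂ a b)
  have hstar : ∀ a, (φ₂ (star a) : A) = star (φ₂ a : A) := fun a =>
    congrArg Subtype.val (map_star φ₂ a)
  -- The values lie in `φ₂(q₁)A` because `φ₂(q₁) φ₂(x) = φ₂(q₁ x) = φ₂(x)`.
  let f : rightIdeal q₁ →ₗ[ℂ] rightIdeal q₂ →ₗ[ℂ] rightIdeal (φ₂ q₁ : A) := LinearMap.mk₂ ℂ
    (fun x y => ⟨(φ₂ x : A) * y, show (φ₂ q₁ : A) * _ = _ by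
      rw [← mul_assoc, ← hmul, rightIdeal_eq]⟩)
    (fun x x' y => Subtype.ext <| show (φ₂ ((x : A) + x') : A) * y = φ₂ x * y + φ₂ x' * y by
      rw [map_add, ← add_mul]; rfl)
    (fun z x y => Subtype.ext <| show (φ₂ (z • (x : A)) : A) * y = z • ((φ₂ x : A) * y) by
      rw [map_smul, ← smul_mul_assoc]; rfl)
    (fun x y y' => Subtype.ext <| mul_add _ _ _)
    (fun z x y => Subtype.ext <| mul_smul_comm _ _ _)
  refine EquivBimodule.tensor_isomorphic f
    (fun (x : rightIdeal q₁) (y : rightIdeal q₂) (x' : rightIdeal q₁) (y' : rightIdeal q₂) => ?_)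
    (fun (x : rightIdeal q₁) (y : rightIdeal q₂) (x' : rightIdeal q₁) (y' : rightIdeal q₂) => ?_) ?_
  -- The left inner product of the target applies the inverse of `φ₂ ∘ φ₁`, so it suffices to apply
  -- `φ₂ ∘ φ₁` to the tensor inner product. Then `φ₁` cancels first, and `φ₂` of `φ₂⁻¹(y y'⋆)`
  -- cancels after multiplicativity splits the product.
  · refine cornerEquiv_symm_eq _ _ _ ?_
    change (φ₂ x : A) * y * star ((φ₂ x' : A) * y') = φ₂ (φ₁ (φ₁.symm ⟨(x : A) *
      φ₂.symm ⟨(y : A) * star (y' : A), mul_star_mem_corner h₂ y y'⟩ * star (x' : A), _⟩))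
    rw [φ₁.apply_symm_apply, hmul, hmul, hstar, φ₂.apply_symm_apply, star_mul]
    simp only [mul_assoc]
  -- No inverse occurs here: both sides are `y⋆ φ₂(x⋆ x') y'`.
  · change star ((φ₂ x : A) * y) * (φ₂ x' * y') = star (y : A) * (φ₂ (star (x : A) * x') * y')
    rw [hmul, hstar, star_mul]
    simp only [mul_assoc]
  -- Every `z` in `φ₂(q₁)A` is the single value `φ₂(q₁) z`, the image of `q₁ ⊗ z`. Here `z` lies in
  -- `q₂A` since `φ₂(q₁)` belongs to the corner of `q₂`.
  · refine dense_univ.mono fun (z : rightIdeal (φ₂ q₁ : A)) _ =>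
      Submodule.subset_span ?_
    have hz : (φ₂ q₁ : A) * (z : A) = z := rightIdeal_eq z
    refine ⟨⟨q₁, h₁.isIdempotentElem.eq⟩, ⟨z, ?_⟩, Subtype.ext hz⟩
    change q₂ * (z : A) = z
    rw [← hz, ← mul_assoc, (φ₂ q₁).2.1]

/-- The isomorphism `qA ⊗ Aq ≅ A`, given by `x ⊗ y ↦ φ⁻¹(x y)`. -/
theorem rightIdealBimodule_tensor_leftIdealBimodule (hf₁ : IsFullProjection q₁)
    (φ : A ≃⋆ₐ[ℂ] corner h₁) :
    ((rightIdealBimodule hf₁ φ).tensor (leftIdealBimodule hf₁ φ)).Isomorphic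
      (trivialBimodule A) := by
  have hmem : ∀ (x : rightIdeal q₁) (y : leftIdeal q₁), (x : A) * y ∈ corner h₁ := fun x y =>
    ⟨by rw [← mul_assoc, rightIdeal_eq], by rw [mul_assoc, leftIdeal_eq]⟩
  let f : rightIdeal q₁ →ₗ[ℂ] leftIdeal q₁ →ₗ[ℂ] A := LinearMap.mk₂ ℂ
    (fun x y => φ.symm ⟨(x : A) * y, hmem x y⟩)
    (fun x x' y => by rw [← map_add]; exact congrArg φ.symm (Subtype.ext <| add_mul _ _ _))
    (fun z x y => by rw [← map_smul]; exact congrArg φ.symm (Subtype.ext <| smul_mul_assoc _ _ _))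
    (fun x y y' => by rw [← map_add]; exact congrArg φ.symm (Subtype.ext <| mul_add _ _ _))
    (fun z x y => by rw [← map_smul]; exact congrArg φ.symm (Subtype.ext <| mul_smul_comm _ _ _))
  refine EquivBimodule.tensor_isomorphic f
    (fun (x : rightIdeal q₁) (y : leftIdeal q₁) (x' : rightIdeal q₁) (y' : leftIdeal q₁) => ?_)
    (fun (x : rightIdeal q₁) (y : leftIdeal q₁) (x' : rightIdeal q₁) (y' : leftIdeal q₁) => ?_) ?_
  -- Both sides are `φ⁻¹(x y y'⋆ x'⋆)`, because `φ⁻¹` is multiplicative and preserves the adjoint on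
  -- the corner.
  · change φ.symm ⟨(x : A) * y, hmem x y⟩ * star (φ.symm ⟨(x' : A) * y', hmem x' y'⟩)
      = φ.symm ⟨(x : A) * ((y : A) * star (y' : A)) * star (x' : A), _⟩
    rw [← map_star, ← map_mul]
    refine congrArg φ.symm (Subtype.ext ?_)
    change (x : A) * y * star ((x' : A) * y') = _
    rw [star_mul]
    simp only [mul_assoc]
  -- Both sides are `φ⁻¹(y⋆ x⋆ x' y')`.
  · change star (φ.symm ⟨(x : A) * y, hmem x y⟩) * φ.symm ⟨(x' : A) * y', hmem x' y'⟩
      = φ.symm ⟨star (y : A) * (star (x : A) * x' * y'), _⟩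
    rw [← map_star, ← map_mul]
    refine congrArg φ.symm (Subtype.ext ?_)
    change star ((x : A) * y) * (x' * y') = _
    rw [star_mul]
    simp only [mul_assoc]
  -- Every `z` is the value at `φ(z) ⊗ q₁`, since `φ(z) q₁ = φ(z)`.
  · refine dense_univ.mono fun z _ => Submodule.subset_span ?_
    exact ⟨⟨φ z, (φ z).2.1⟩, ⟨q₁, h₁.isIdempotentElem.eq⟩, cornerEquiv_symm_eq φ _ _ (φ z).2.2⟩

/-- The isomorphism `Aq ⊗ qA ≅ A`, given by `x ⊗ y ↦ x y`. -/
theorem leftIdealBimodule_tensor_rightIdealBimodule (hf₁ : IsFullProjection q₁)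
    (φ : A ≃⋆ₐ[ℂ] corner h₁) :
    ((leftIdealBimodule hf₁ φ).tensor (rightIdealBimodule hf₁ φ)).Isomorphic
      (trivialBimodule A) := by
  let f : leftIdeal q₁ →ₗ[ℂ] rightIdeal q₁ →ₗ[ℂ] A := LinearMap.mk₂ ℂ
    (fun x y => (x : A) * y) (fun x x' y => add_mul _ _ _) (fun z x y => smul_mul_assoc _ _ _)
    (fun x y y' => mul_add _ _ _) (fun z x y => mul_smul_comm _ _ _)
  refine EquivBimodule.tensor_isomorphic f
    (fun (x : leftIdeal q₁) (y : rightIdeal q₁) (x' : leftIdeal q₁) (y' : rightIdeal q₁) => ?_)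
    (fun (x : leftIdeal q₁) (y : rightIdeal q₁) (x' : leftIdeal q₁) (y' : rightIdeal q₁) => ?_) ?_
  -- The right action on `Aq` goes through `φ` and the left inner product of `qA` through `φ⁻¹`, so
  -- the two cancel and leave `x y y'⋆ x'⋆`.
  · change (x : A) * y * star ((x' : A) * y') = (x : A) *
      φ (φ.symm ⟨(y : A) * star (y' : A), mul_star_mem_corner h₁ y y'⟩) * star (x' : A)
    rw [φ.apply_symm_apply, star_mul]
    simp only [mul_assoc]
  -- Likewise the left action on `qA` cancels the `φ⁻¹` in the right inner product of `Aq`.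
  · change star ((x : A) * y) * (x' * y') = star (y : A) *
      (φ (φ.symm ⟨star (x : A) * x', star_mul_mem_corner h₁ x x'⟩) * y')
    rw [φ.apply_symm_apply, star_mul]
    simp only [mul_assoc]
  -- Fullness supplies the density: each generator `a q b` of the ideal factors as `(a q)(q b)`
  -- because `q` is idempotent.
  · refine Dense.mono (Submodule.span_mono ?_) hf₁
    rintro _ ⟨a, b, rfl⟩
    have hi : q₁ * q₁ = q₁ := h₁.isIdempotentElem.eq
    refine ⟨⟨a * q₁, show _ * q₁ = _ by rw [mul_assoc, hi]⟩,
      ⟨q₁ * b, show q₁ * _ = _ by rw [← mul_assoc, hi]⟩, ?_⟩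
    change a * q₁ * (q₁ * b) = a * q₁ * b
    rw [← mul_assoc, mul_assoc a, hi]

end Corner

/-! ### The trace of `A_θ`: trace property, uniqueness, scaling under corner isomorphisms -/

section Trace

open Filter Topology

variable {θ : ℝ}

/-- Both products are scalar multiples of `rotM θ (g + h)`, on which the vector state vanishes
unless `g + h = 0`. In the exceptional case `h = -g`, the exponent of the commutation phase is zero
and the two operators commute. Irrationality of `θ` plays no role. -/
theorem vecState_rotM_mul_comm (g h : ℤ × ℤ) :
    vecState (rotM θ g * rotM θ h) = vecState (rotM θ h * rotM θ g) := by
  by_cases hgh : g + h = 0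
  · have h1 : g.1 * h.2 - h.1 * g.2 = 0 := by
      rw [← neg_eq_of_add_eq_zero_right hgh, Prod.fst_neg, Prod.snd_neg]
      ring
    rw [rotM_comm, h1, rotScalar_zero, one_smul]
  · rw [rotM_mul, rotM_mul, vecState_smul, vecState_smul, vecState_rotM hgh,
      vecState_rotM (add_comm g h ▸ hgh), mul_zero, mul_zero]

theorem continuous_vecState : Continuous vecState := by
  refine AddMonoidHomClass.continuous_of_bound (AddMonoidHom.mk' vecState vecState_add) 1
    fun x => ?_
  rw [one_mul]
  exact norm_vecState_le x

/-- The vector state is a trace on `A_θ`. -/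
theorem vecState_mul_comm {x y : SqSummable →L[ℂ] SqSummable} (hx : x ∈ rotationSubalgebra θ)
    (hy : y ∈ rotationSubalgebra θ) : vecState (x * y) = vecState (y * x) := by
  -- Commutation under the state with a fixed `z` is a closed linear condition on the other factor,
  -- so it passes from the operators `rotM θ g` to the whole algebra.
  have key : ∀ z : SqSummable →L[ℂ] SqSummable,
      (∀ g, vecState (rotM θ g * z) = vecState (z * rotM θ g)) →
      ∀ x ∈ rotationSubalgebra θ, vecState (x * z) = vecState (z * x) := by
    intro z hz x hx
    have hcl : IsClosed {x : SqSummable →L[ℂ] SqSummable | vecState (x * z) = vecState (z * x)} :=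
      isClosed_eq (continuous_vecState.comp (continuous_mul_const z))
        (continuous_vecState.comp (continuous_const_mul z))
    refine closure_minimal (fun y hy => ?_) hcl (mem_closure_span_rotM hx)
    change vecState (y * z) = vecState (z * y)
    induction hy using Submodule.span_induction with
    | mem y hy => obtain ⟨g, rfl⟩ := hy; exact hz g
    | zero => rw [mul_zero, zero_mul]
    | add y y' _ _ h1 h2 => rw [mul_add, add_mul, vecState_add, vecState_add, h1, h2]
    | smul c y _ h1 => rw [mul_smul_comm, smul_mul_assoc, vecState_smul, vecState_smul, h1]
  -- The extension is made twice: the inner use, with `z = rotM θ g`, frees `y`; the outer use, with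
  -- `z = y`, frees `x`.
  exact key y (fun g => (key _ (fun h => vecState_rotM_mul_comm h g) y hy).symm) x hx

/-- A continuous trace on `A_θ` is a multiple of the canonical trace. -/
theorem eq_rotationTrace_mul (hθ : Irrational θ) (τ : RotationAlgebra θ →L[ℂ] ℂ)
    (hτ : ∀ a b, τ (a * b) = τ (b * a)) (a : RotationAlgebra θ) :
    τ a = rotationTrace θ a * τ 1 := by
  let M : ℤ × ℤ → RotationAlgebra θ := fun g => ⟨rotM θ g, rotM_mem g⟩
  have hM : ∀ g, star (M g) * M g = 1 := fun g => Subtype.ext (star_mul_weightedShift _ _)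
  -- These are the averages `rotAvg θ n a`, rebuilt inside `A_θ` so that `τ`, which is defined only
  -- there, can be applied to them.
  let T : ℕ → RotationAlgebra θ := fun n => ((n : ℂ)⁻¹ * (n : ℂ)⁻¹) •
    ∑ j ∈ Finset.range n, ∑ k ∈ Finset.range n, M (j, k) * a * star (M (j, k))
  have hlim : Tendsto T atTop (𝓝 (rotationTrace θ a • 1)) := by
    rw [tendsto_subtype_rng]
    refine (tendsto_rotAvg hθ a.2).congr fun n => ?_
    simp only [T, M, rotAvg]
    push_cast
    rfl
  -- The case `n = 0` is excluded because the empty average is `0`. Otherwise all `n²` conjugates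
  -- have the value `τ a`, by the trace property and unitarity.
  have hT : ∀ n ≠ 0, τ (T n) = τ a := by
    intro n hn
    have hn' : (n : ℂ) ≠ 0 := Nat.cast_ne_zero.2 hn
    have h1 : ∀ g, τ (M g * a * star (M g)) = τ a := fun g => by
      rw [hτ, ← mul_assoc, hM, one_mul]
    simp only [T, map_smul, map_sum, h1, Finset.sum_const, Finset.card_range, smul_eq_mul,
      nsmul_eq_mul]
    field_simp
  have h2 : Tendsto (fun n => τ (T n)) atTop (𝓝 (τ a)) :=
    tendsto_const_nhds.congr' <| (eventually_ne_atTop 0).mono fun n hn => (hT n hn).symm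
  -- The sequence `τ (T n)` is eventually constant with value `τ a`, and by continuity it tends to
  -- `τ (rotationTrace θ a • 1)`; the two limits agree.
  rw [tendsto_nhds_unique h2 ((τ.continuous.tendsto _).comp hlim), map_smul, smul_eq_mul]

/-- Pulling the trace back along `φ` gives a bounded trace on `A_θ`, and uniqueness leaves only its
value at `1` to be found. With `a = q₁` and `φ = φ₂` this is multiplicativity of the trace on
projections. -/
theorem rotationTrace_cornerEquiv (hθ : Irrational θ) {q : RotationAlgebra θ}
    {hq : IsStarProjection q} (φ : RotationAlgebra θ ≃⋆ₐ[ℂ] corner hq) (a : RotationAlgebra θ) :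
    rotationTrace θ (φ a) = rotationTrace θ a * rotationTrace θ q := by
  let τ₀ : RotationAlgebra θ →ₗ[ℂ] ℂ :=
    { toFun := fun a => rotationTrace θ (φ a)
      map_add' := fun a b => by rw [map_add]; exact vecState_add _ _
      map_smul' := fun z a => by rw [map_smul]; exact vecState_smul _ _ }
  -- The bound `1` comes from `φ` being isometric, as an injective star homomorphism, and from the
  -- vector state having norm at most `1`.
  let τ : RotationAlgebra θ →L[ℂ] ℂ := τ₀.mkContinuous 1 fun a => by
    rw [one_mul, ← cornerEquiv_norm φ]
    exact norm_vecState_le _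
  have h := eq_rotationTrace_mul hθ τ (fun a b => by
    change rotationTrace θ (φ (a * b)) = rotationTrace θ (φ (b * a))
    rw [map_mul, map_mul]
    exact vecState_mul_comm (φ a : RotationAlgebra θ).2 (φ b : RotationAlgebra θ).2) a
  -- The isomorphism `φ` sends `1` to the unit of the corner, which is `q`.
  have h1 : τ 1 = rotationTrace θ q := congrArg (rotationTrace θ) (cornerEquiv_one φ)
  rwa [h1] at h

end Trace

theorem mainTheorem8 (θ : ℝ) (hθ : Irrational θ) {q₁ q₂ : RotationAlgebra θ}
    (h₁ : IsStarProjection q₁) (h₂ : IsStarProjection q₂)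
    (φ₁ : RotationAlgebra θ ≃⋆ₐ[ℂ] corner h₁) (φ₂ : RotationAlgebra θ ≃⋆ₐ[ℂ] corner h₂) :
    (rotationTrace θ (φ₂ q₁) = rotationTrace θ q₁ * rotationTrace θ q₂ ∧
      ((realMultE hθ φ₁).tensor (realMultE hθ φ₂)).Isomorphic
        (realMultE hθ (cornerComp φ₁ φ₂))) ∧
    ((realMultE hθ φ₁).tensor (realMultF hθ φ₁)).Isomorphic
      (trivialBimodule (RotationAlgebra θ)) ∧
    ((realMultF hθ φ₁).tensor (realMultE hθ φ₁)).Isomorphic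
      (trivialBimodule (RotationAlgebra θ)) :=
  -- The omitted arguments are the proofs of fullness contained in `realMultE` and `realMultF`: each
  -- projection is nonzero as the image of `1`, hence full for irrational `θ`.
  ⟨⟨rotationTrace_cornerEquiv hθ φ₂ q₁, rightIdealBimodule_tensor_isomorphic _ _ φ₁ φ₂ _⟩,
    rightIdealBimodule_tensor_leftIdealBimodule _ φ₁,
    leftIdealBimodule_tensor_rightIdealBimodule _ φ₁⟩
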